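/- Let $\mathbb{D}=\{z\in\mathbb{C}:|z|<1\}$ and $k\in[0,1]$. Let $\mathcal{H}_k$ be the set of harmonic mappings $f=h+\overline{g}$ on $\mathbb{D}$, where $h(z)=\sum_{n\ge 0}a_nz^n$ and $g(z)=\sum_{n\ge 1}b_nz^n$ are analytic in $\mathbb{D}$ (so $g(0)=0$), with $|h|\le 1$ and $|g'|\le k|h'|$ in $\mathbb{D}$. Put $h_0=h-h(0)$, $c(0)=0$, $c(k)=1/k$ for $k\in(0,1]$, and for $0\le r<1$ $$E_f(k,r)=\sum_{n=1}^\infty|a_n|r^n+\sum_{n=1}^\infty|b_n|r^n+\frac{1}{1+|a_0|}\left(\frac{1+|a_0|r}{1-r}\right)\left(\sum_{n=1}^\infty|a_n|^2r^{2n}+c(k)\sum_{n=1}^\infty|b_n|^2r^{2n}\right).$$ Let $p\in(0,2]$, and for $a\in[0,1)$ put $$r_k^p(a)=\frac{1-a^p}{1-a^p+(1+k)(1-a^2)}.$$ (i) Let $f=h+\overline{g}\in\mathcal{H}_k$ with $h$ not constant, let $a=|h(0)|$ (so $a<1$) and let $q$ be the order of the zero of $h_0$ at $0$. If $k=0$ or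 $|b_q|\le \frac{1}{2k|a_q|}$, then $$a^p+E_f(k,r)\le 1\quad\text{for } 0\le r\le r_k^p(a).$$ (ii) The inequality in (i) holds without the condition on $b_q$, for every $f=h+\overline g\in\mathcal{H}_k$ with $h$ not constant and $a=|h(0)|$, in each of the following cases: $k=0$; $k=1$; $p\in(0,1]$; $k\in(0,1)$, $p\in(1,2)$ and $k\ge\frac{1+a^2-2a^p}{1-a^2}$. (iii) In the cases listed in (ii) the inequality is sharp: for all such $k$, $p$ and $a\in[0,1)$ there is $f=h+\overline{g}\in\mathcal{H}_k$ with $h$ not constant and $|h(0)|=a$ such that $a^p+E_f(k,r)=1$ for $r=r_k^p(a)$ and $a^p+E_f(k,r)>1$ for all $r\in(r_k^p(a),1)$. -/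

import Mathlib

namespace BohrHarmonic

open Metric

/-- The `n`-th Taylor coefficient at `0` of a function analytic near `0`. -/
noncomputable def taylorCoeff (u : ℂ → ℂ) (n : ℕ) : ℂ :=
  iteratedDeriv n u 0 / (n.factorial : ℂ)

/-- `f = h + conj g` belongs to the family `H_k`: on the open unit disk `h` and `g` are analytic,
`g 0 = 0`, `|h| ≤ 1` and `|g'| ≤ k |h'|`. -/
structure IsInHk (k : ℝ) (f h g : ℂ → ℂ) : Prop where
  analytic_h : DifferentiableOn ℂ h (ball 0 1)
  analytic_g : DifferentiableOn ℂ g (ball 0 1)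
  g_zero : g 0 = 0
  decomp : ∀ z ∈ ball (0 : ℂ) 1, f z = h z + (starRingEnd ℂ) (g z)
  norm_h_le : ∀ z ∈ ball (0 : ℂ) 1, ‖h z‖ ≤ 1
  norm_deriv_le : ∀ z ∈ ball (0 : ℂ) 1, ‖deriv g z‖ ≤ k * ‖deriv h z‖

/-- `u` is not constant on the open unit disk. -/
def NonconstOnDisk (u : ℂ → ℂ) : Prop :=
  ∃ z ∈ ball (0 : ℂ) 1, u z ≠ u 0

/-- The majorant series `∑_{n ≥ 1} |u_n| r ^ n`. -/
noncomputable def majorant (u : ℂ → ℂ) (r : ℝ) : ℝ :=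
  ∑' n : ℕ, ‖taylorCoeff u (n + 1)‖ * r ^ (n + 1)

/-- The quantity `‖u‖_r² = ∑_{n ≥ 1} |u_n|² r ^ (2 n)`, for `u` with `u 0 = 0`. -/
noncomputable def normSqR (u : ℂ → ℂ) (r : ℝ) : ℝ :=
  ∑' n : ℕ, ‖taylorCoeff u (n + 1)‖ ^ 2 * r ^ (2 * (n + 1))

/-- `c(0) = 0` and `c(k) = 1 / k` for `k ≠ 0`. -/
noncomputable def cCoeff (k : ℝ) : ℝ :=
  if k = 0 then 0 else 1 / k

/-- The quantity `E_f(k, r)` of `f = h + conj g`. -/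
noncomputable def bohrE (k : ℝ) (h g : ℂ → ℂ) (r : ℝ) : ℝ :=
  majorant h r + majorant g r
    + 1 / (1 + ‖h 0‖) * ((1 + ‖h 0‖ * r) / (1 - r))
      * (normSqR (fun z => h z - h 0) r + cCoeff k * normSqR g r)

/-- The radius `r_k^p(a)`. -/
noncomputable def bohrRadius (k p a : ℝ) : ℝ :=
  (1 - a ^ p) / (1 - a ^ p + (1 + k) * (1 - a ^ 2))

/-- The parameters for which no condition on the coefficients is needed. -/
def FreeRange (k p a : ℝ) : Prop :=
  k = 0 ∨ k = 1 ∨ p ≤ 1 ∨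
    (0 < k ∧ k < 1 ∧ 1 < p ∧ p < 2 ∧ (1 + a ^ 2 - 2 * a ^ p) / (1 - a ^ 2) ≤ k)

/-- All terms of the majorant series are meaningful: the series converges for `0 ≤ r < 1`. -/
theorem summable_majorant {u : ℂ → ℂ} (hu : DifferentiableOn ℂ u (ball 0 1)) {r : ℝ}
    (hr0 : 0 ≤ r) (hr1 : r < 1) :
    Summable fun n : ℕ => ‖taylorCoeff u (n + 1)‖ * r ^ (n + 1) := by
  have hz : (r : ℂ) ∈ ball (0 : ℂ) 1 := by
    simp [abs_of_nonneg hr0, hr1]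
  have hs := (Complex.hasSum_taylorSeries_on_ball hu hz).summable.norm
  have ht : Summable fun n : ℕ => ‖taylorCoeff u n‖ * r ^ n := by
    refine hs.congr fun n => ?_
    rw [sub_zero, taylorCoeff, smul_eq_mul, smul_eq_mul, norm_mul, norm_mul, norm_div, norm_inv,
      norm_pow, Complex.norm_real, Real.norm_of_nonneg hr0, div_eq_mul_inv]
    ring
  exact (summable_nat_add_iff (f := fun n : ℕ => ‖taylorCoeff u n‖ * r ^ n) 1).2 ht

/-- The series defining `‖u‖_r²` converges for `0 ≤ r < 1`. -/
theorem summable_normSqR {u : ℂ → ℂ} (hu : DifferentiableOn ℂ u (ball 0 1)) {r : ℝ}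
    (hr0 : 0 ≤ r) (hr1 : r < 1) :
    Summable fun n : ℕ => ‖taylorCoeff u (n + 1)‖ ^ 2 * r ^ (2 * (n + 1)) := by
  have hs := summable_majorant hu hr0 hr1
  have h0 : ∀ n : ℕ, 0 ≤ ‖taylorCoeff u (n + 1)‖ * r ^ (n + 1) :=
    fun n => mul_nonneg (norm_nonneg _) (pow_nonneg hr0 _)
  refine (hs.mul_left (∑' n : ℕ, ‖taylorCoeff u (n + 1)‖ * r ^ (n + 1))).of_nonneg_of_le
    (fun n => mul_nonneg (sq_nonneg _) (pow_nonneg hr0 _)) fun n => ?_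
  calc ‖taylorCoeff u (n + 1)‖ ^ 2 * r ^ (2 * (n + 1))
      = (‖taylorCoeff u (n + 1)‖ * r ^ (n + 1)) * (‖taylorCoeff u (n + 1)‖ * r ^ (n + 1)) := by
        ring
    _ ≤ _ := mul_le_mul_of_nonneg_right (hs.le_tsum n fun m _ => h0 m) (h0 n)

end BohrHarmonic

namespace BohrHarmonic

open Metric
-- Write a = |h(0)|, A = 1 - a² and δ = (A - |a_1|) r, which is nonnegative. Both inequalities
-- follow from one bound for the whole class, E_f(k,r) ≤ (1+k) A r/(1-r) for r ≤ 1/2 (`bohrE_le`).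
-- The radius r_k^p(a) is the solution of (1+k) A r/(1-r) = 1 - a^p, and p ≤ 2 forces it to be at
-- most 1/2. For a disk automorphism h and g = k (h - h(0)) the bound is an equality at every r < 1;
-- since r/(1-r) increases, this gives sharpness.
--
-- For the bound, factor g' = φ · k h' with φ analytic and |φ| ≤ 1. Let M and N be the linear and
-- quadratic majorant series and C the factor in front of the quadratic part of E_f. Three estimates
-- are combined: (1) M_h + C N_h ≤ A r/(1-r) - δ (`refined_bohr`); (2) M_g ≤ k (M_h + δ) for r ≤ 1/2
-- (`majorant_le_of_deriv_eq`); (3) N_g ≤ k² N_h (`normSqR_le_of_deriv_eq`). Since c(k) k² = k, they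
-- add up to (1+k)(A r/(1-r) - δ) + kδ: the error δ allowed in (2) is paid for by the gain in (1).
--
-- Truncated Toeplitz matrices of a function bounded by one are contractions. This gives Carlson's
-- coefficient inequalities, hence (1) and the coefficient bounds used in (2), and, after summation
-- by parts, (3).
-- Real inequalities for finite sums
open Finset in
/-- Weighted sums of prefix-dominated sequences are ordered when the weights decrease. -/
theorem sum_mul_nonneg_of_prefix_nonneg {w d : ℕ → ℝ} (hw : Antitone w)
    (hd : ∀ N, 0 ≤ ∑ n ∈ range N, d n) (N : ℕ) :
    w N * ∑ n ∈ range N, d n ≤ ∑ n ∈ range N, w n * d n := by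
  induction N with
  | zero => simp
  | succ N ih =>
    have h1 := mul_le_mul_of_nonneg_right (hw N.le_succ) (hd (N + 1))
    rw [sum_range_succ (fun n => w n * d n)]
    rw [sum_range_succ] at h1 ⊢
    linarith [mul_add (w N) (∑ n ∈ range N, d n) (d N)]

open Finset in
theorem sum_succ_mul_le {A : ℝ} {x : ℕ → ℝ} (hx : ∀ n, x n ≤ A) (N : ℕ) :
    ∑ j ∈ range N, ((j : ℝ) + 1) * x j ≤ A * (N * (N + 1) / 2) := by
  induction N with
  | zero => simp
  | succ N ih =>
    rw [sum_range_succ]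
    have := mul_le_mul_of_nonneg_left (hx N) (by positivity : (0 : ℝ) ≤ N + 1)
    push_cast
    nlinarith

open Finset in
/-- The averaging inequality behind the majorant comparison, with its remainder terms. -/
theorem averaged_series_le_aux {A r : ℝ} {x : ℕ → ℝ} (hx0 : ∀ n, 0 ≤ x n) (hx : ∀ n, x n ≤ A)
    (hr0 : 0 ≤ r) (hr : r ≤ 1 / 2) (M : ℕ) :
    ∑ n ∈ range (M + 2), 2 * r ^ (n + 1) * (∑ j ∈ range n, ((j : ℝ) + 1) * x j) / (n + 1)
      + 2 * r ^ (M + 3) * (∑ j ∈ range (M + 2), ((j : ℝ) + 1) * x j) / (M + 2)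
      + A * (M + 1) * r * (1 / 2) ^ (M + 2)
      ≤ A * r + ∑ n ∈ range (M + 1), x (n + 1) * r ^ (n + 2) := by
  induction M with
  | zero =>
    simp [sum_range_succ]
    have h0 := hx0 0
    have h1 := hx0 1
    have hA : 0 ≤ A := h0.trans (hx 0)
    have e1 : r ^ 3 * x 1 ≤ r ^ 2 * (1 / 2) * x 1 := by
      apply mul_le_mul_of_nonneg_right _ h1
      nlinarith [pow_nonneg hr0 2]
    have e2 : r ^ 2 * x 0 ≤ r * (1 / 2) * A := by
      apply mul_le_mul _ (hx 0) h0 (by positivity)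
      nlinarith
    have e3 : r ^ 3 * x 0 ≤ r * (1 / 4) * A := by
      apply mul_le_mul _ (hx 0) h0 (by positivity)
      have : r ^ 2 ≤ 1 / 4 := by nlinarith
      nlinarith
    nlinarith
  | succ M ih =>
    rw [sum_range_succ _ (M + 2), sum_range_succ (fun n => x (n + 1) * r ^ (n + 2)) (M + 1),
      sum_range_succ (fun j => ((j : ℝ) + 1) * x j) (M + 2)]
    have hu := sum_succ_mul_le hx (M + 2)
    have hA : 0 ≤ A := (hx0 0).trans (hx 0)
    have hu0 : 0 ≤ ∑ j ∈ range (M + 2), ((j : ℝ) + 1) * x j :=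
      sum_nonneg fun j _ => mul_nonneg (by positivity) (hx0 j)
    generalize ∑ j ∈ range (M + 2), ((j : ℝ) + 1) * x j = u at *
    have hy := hx0 (M + 2)
    have hpow : r ^ (M + 2) ≤ (1 / 2) ^ (M + 2) := pow_le_pow_left₀ hr0 hr _
    -- The new term on the right is r^(M+3) x_{M+2}; since r ≤ 1/2 it pays for the 2 r^(M+4) x_{M+2}
    -- that enters the first remainder.
    have e1 : r ^ (M + 4) * x (M + 2) ≤ 1 / 2 * (r ^ (M + 3) * x (M + 2)) := by
      have : r ^ (M + 4) = r * r ^ (M + 3) := by ring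
      rw [this, mul_assoc]
      exact mul_le_mul_of_nonneg_right hr (by positivity)
    -- The part carried by the old sum `u` may grow, because r (M+2) - 1 can be as large as M/2.
    -- With u ≤ A (M+2)(M+3)/2 the growth is exactly what the second remainder releases in `e4`.
    have e2 : 2 * r ^ (M + 3) * u / (M + 3) + 2 * r ^ (M + 4) * u / (M + 3)
        - 2 * r ^ (M + 3) * u / (M + 2) ≤ A * M / 2 * r * (1 / 2) ^ (M + 2) := by
      push_cast at hu
      have h3 : 2 * r ^ (M + 3) * u / (M + 3) + 2 * r ^ (M + 4) * u / (M + 3)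
        - 2 * r ^ (M + 3) * u / (M + 2)
          = (2 * r ^ (M + 3) / ((M + 2) * (M + 3))) * ((r * (M + 2) - 1) * u) := by
        field_simp
        ring
      have h4 : (r * (M + 2) - 1) * u ≤ (M / 2) * (A * ((M + 2) * (M + 3) / 2)) := by
        calc (r * (M + 2) - 1) * u ≤ (M / 2) * u := by
              apply mul_le_mul_of_nonneg_right _ hu0
              have : (0 : ℝ) ≤ M := by positivity
              nlinarith
          _ ≤ _ := mul_le_mul_of_nonneg_left (by linarith) (by positivity)
      rw [h3]
      calc _ ≤ (2 * r ^ (M + 3) / ((M + 2) * (M + 3))) *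
            ((M / 2) * (A * ((M + 2) * (M + 3) / 2))) :=
            mul_le_mul_of_nonneg_left h4 (by positivity)
        _ = A * M / 2 * r * r ^ (M + 2) := by
            field_simp
            ring
        _ ≤ _ := mul_le_mul_of_nonneg_left hpow (by positivity)
    have e3 : 2 * r ^ (M + 4) * (u + ((M : ℝ) + 3) * x (M + 2)) / (M + 3)
        = 2 * r ^ (M + 4) * u / (M + 3) + 2 * r ^ (M + 4) * x (M + 2) := by
      field_simp
    push_cast
    have c1 : ((M : ℝ) + 2 + 1) = M + 3 := by ring
    have c2 : ((M : ℝ) + 1 + 2) = M + 3 := by ring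
    have c3 : ((M : ℝ) + 1 + 1) = M + 2 := by ring
    have n1 : M + 2 + 1 = M + 3 := rfl
    have n2 : M + 1 + 3 = M + 4 := rfl
    have n3 : M + 1 + 1 = M + 2 := rfl
    simp only [c1, c2, c3, n1, n2, n3] at ih ⊢
    rw [e3]
    have e4 : A * (M + 2) * r * (1 / 2) ^ (M + 3)
        = A * (M + 1) * r * (1 / 2) ^ (M + 2) - A * M / 2 * r * (1 / 2) ^ (M + 2) := by
      ring
    rw [e4]
    linarith

-- Both remainders are nonnegative and are dropped; x_0 r is moved into the series.
open Finset in
theorem averaged_series_le {A r : ℝ} {x : ℕ → ℝ} (hx0 : ∀ n, 0 ≤ x n) (hx : ∀ n, x n ≤ A)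
    (hr0 : 0 ≤ r) (hr : r ≤ 1 / 2) (M : ℕ) :
    ∑ n ∈ range (M + 2), 2 * r ^ (n + 1) * (∑ j ∈ range n, ((j : ℝ) + 1) * x j) / (n + 1)
      ≤ (A - x 0) * r + ∑ n ∈ range (M + 2), x n * r ^ (n + 1) := by
  have h := averaged_series_le_aux hx0 hx hr0 hr M
  have hA : 0 ≤ A := (hx0 0).trans (hx 0)
  have hu0 : 0 ≤ ∑ j ∈ range (M + 2), ((j : ℝ) + 1) * x j :=
    sum_nonneg fun j _ => mul_nonneg (by positivity) (hx0 j)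
  have h1 : 0 ≤ 2 * r ^ (M + 3) * (∑ j ∈ range (M + 2), ((j : ℝ) + 1) * x j) / (M + 2) := by
    positivity
  have h2 : 0 ≤ A * (M + 1) * r * (1 / 2) ^ (M + 2) := by positivity
  rw [sum_range_succ' (fun n => x n * r ^ (n + 1))]
  simp only [zero_add, pow_one]
  have : ∀ n, n + 1 + 1 = n + 2 := fun _ => rfl
  simp only [this]
  linarith

open Finset in
/-- Finite form of the refined Bohr inequality, from Carlson-type coefficient bounds. The `x n`
stand for the coefficients of index `n + 1`. -/
theorem refined_bohr_finite {a r : ℝ} {x : ℕ → ℝ} (ha : 0 ≤ a) (hr0 : 0 ≤ r) (hr1 : r < 1)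
    (hodd : ∀ n, x (2 * n) ≤ 1 - a ^ 2 - ∑ j ∈ range n, x j ^ 2)
    (heven : ∀ n, x (2 * n + 1) ≤ 1 - a ^ 2 - ∑ j ∈ range n, x j ^ 2 - x n ^ 2 / (1 + a))
    (K : ℕ) :
    ∑ n ∈ range (2 * K + 1), x n * r ^ (n + 1)
      + 1 / (1 + a) * ((1 + a * r) / (1 - r)) * ∑ n ∈ range K, x n ^ 2 * r ^ (2 * (n + 1))
      ≤ (1 - a ^ 2) * ((r - r ^ (2 * K + 2)) / (1 - r)) - (1 - a ^ 2 - x 0) * r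
        + (∑ n ∈ range K, x n ^ 2) * (r ^ (2 * K + 2) / (1 - r)) := by
  have h1r : 0 < 1 - r := by linarith
  have h1a : 0 < 1 + a := by linarith
  induction K with
  | zero =>
    have : (r - r ^ 2) / (1 - r) = r := by field_simp
    simp [this]
    linarith
  | succ K ih =>
    rw [show 2 * (K + 1) + 1 = 2 * K + 1 + 1 + 1 from rfl, sum_range_succ _ (2 * K + 1 + 1),
      sum_range_succ _ (2 * K + 1), sum_range_succ _ K, sum_range_succ _ K]
    have h1 := mul_le_mul_of_nonneg_right (heven K) (pow_nonneg hr0 (2 * K + 2))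
    have h2 := mul_le_mul_of_nonneg_right (hodd (K + 1)) (pow_nonneg hr0 (2 * K + 3))
    rw [sum_range_succ] at h2
    generalize ∑ n ∈ range K, x n ^ 2 = S at *
    generalize ∑ n ∈ range K, x n ^ 2 * r ^ (2 * (n + 1)) = T at *
    generalize ∑ n ∈ range (2 * K + 1), x n * r ^ (n + 1) = V at *
    have e1 : (1 - a ^ 2) * ((r - r ^ (2 * (K + 1) + 2)) / (1 - r))
        = (1 - a ^ 2) * ((r - r ^ (2 * K + 2)) / (1 - r))
          + (1 - a ^ 2) * (r ^ (2 * K + 2) + r ^ (2 * K + 3)) := by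
      field_simp
      ring
    have e2 : (S + x K ^ 2) * (r ^ (2 * (K + 1) + 2) / (1 - r))
        = S * (r ^ (2 * K + 2) / (1 - r)) - S * (r ^ (2 * K + 2) + r ^ (2 * K + 3))
          + x K ^ 2 * (r ^ (2 * K + 4) / (1 - r)) := by
      field_simp
      ring
    -- The weight of x_K² splits into three parts: the first two are the deficits in the bounds for
    -- the two new coefficients, the last covers all later ones, summed geometrically.
    have e3 : 1 / (1 + a) * ((1 + a * r) / (1 - r)) * (T + x K ^ 2 * r ^ (2 * (K + 1)))
        = 1 / (1 + a) * ((1 + a * r) / (1 - r)) * T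
          + x K ^ 2 / (1 + a) * r ^ (2 * K + 2) + x K ^ 2 * r ^ (2 * K + 3)
          + x K ^ 2 * (r ^ (2 * K + 4) / (1 - r)) := by
      field_simp
      ring
    rw [e1, e2, e3]
    have c1 : x (2 * (K + 1)) = x (2 * K + 1 + 1) := rfl
    have c2 : 2 * K + 1 + 1 = 2 * K + 2 := rfl
    have c3 : 2 * K + 1 + 1 + 1 = 2 * K + 3 := rfl
    rw [c1] at h2
    simp only [c2, c3] at *
    nlinarith
-- Fourier integrals and Toeplitz contractions
theorem hasSum_taylorCoeff {u : ℂ → ℂ} (hu : DifferentiableOn ℂ u (ball 0 1)) {z : ℂ}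
    (hz : z ∈ ball (0 : ℂ) 1) : HasSum (fun n => taylorCoeff u n * z ^ n) (u z) := by
  refine (Complex.hasSum_taylorSeries_on_ball hu hz).congr_fun fun n => ?_
  rw [sub_zero, taylorCoeff, smul_eq_mul, smul_eq_mul]
  ring

theorem summable_norm_taylorCoeff {u : ℂ → ℂ} (hu : DifferentiableOn ℂ u (ball 0 1)) {r : ℝ}
    (hr0 : 0 ≤ r) (hr1 : r < 1) : Summable fun n => ‖taylorCoeff u n‖ * r ^ n :=
  (summable_nat_add_iff (f := fun n : ℕ => ‖taylorCoeff u n‖ * r ^ n) 1).1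
    (summable_majorant hu hr0 hr1)

/-- Orthogonality of the exponentials on the circle. -/
theorem integral_exp_int_mul (m : ℤ) :
    ∫ t in (0 : ℝ)..2 * Real.pi, Complex.exp ((m : ℂ) * Complex.I * t)
      = if m = 0 then (2 * Real.pi : ℂ) else 0 := by
  split_ifs with hm
  · simp [hm]
  · rw [integral_exp_mul_complex (by simp [hm])]
    have : (m : ℂ) * Complex.I * ((2 * Real.pi : ℝ) : ℂ) = m * (2 * Real.pi * Complex.I) := by
      push_cast; ring
    rw [this, Complex.exp_int_mul_two_pi_mul_I]
    simp

/-- Integrate the Taylor series term by term on the circle of radius r; orthogonality keeps only n =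
i - j, which requires j ≤ i. -/
theorem integral_mul_exp {u : ℂ → ℂ} (hu : DifferentiableOn ℂ u (ball 0 1)) {r : ℝ}
    (hr0 : 0 ≤ r) (hr1 : r < 1) (i j : ℕ) :
    ∫ t in (0 : ℝ)..2 * Real.pi, u (r * Complex.exp (Complex.I * t))
        * Complex.exp (((j : ℤ) - (i : ℤ) : ℤ) * Complex.I * t)
      = 2 * Real.pi * (if j ≤ i then taylorCoeff u (i - j) * r ^ (i - j) else 0) := by
  have hz : ∀ t : ℝ, (r : ℂ) * Complex.exp (Complex.I * t) ∈ ball (0 : ℂ) 1 := by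
    intro t
    simp [Complex.norm_exp, abs_of_nonneg hr0, hr1]
  have key : HasSum (fun n => ∫ t in (0 : ℝ)..2 * Real.pi,
      taylorCoeff u n * (r * Complex.exp (Complex.I * t)) ^ n
        * Complex.exp (((j : ℤ) - (i : ℤ) : ℤ) * Complex.I * t))
      (∫ t in (0 : ℝ)..2 * Real.pi, u (r * Complex.exp (Complex.I * t))
        * Complex.exp (((j : ℤ) - (i : ℤ) : ℤ) * Complex.I * t)) := by
    refine intervalIntegral.hasSum_integral_of_dominated_convergence
      (fun n _ => ‖taylorCoeff u n‖ * r ^ n) (fun n => ?_) (fun n => ?_) ?_ ?_ ?_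
    · exact Continuous.aestronglyMeasurable (by fun_prop)
    · refine Filter.Eventually.of_forall fun t _ => ?_
      simp [Complex.norm_exp, abs_of_nonneg hr0]
    · exact Filter.Eventually.of_forall fun t _ => summable_norm_taylorCoeff hu hr0 hr1
    · exact intervalIntegrable_const
    · exact Filter.Eventually.of_forall fun t _ => (hasSum_taylorCoeff hu (hz t)).mul_right _
  have term : ∀ n, ∫ t in (0 : ℝ)..2 * Real.pi,
      taylorCoeff u n * (r * Complex.exp (Complex.I * t)) ^ n
        * Complex.exp (((j : ℤ) - (i : ℤ) : ℤ) * Complex.I * t)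
      = if n + j = i then (2 * Real.pi : ℂ) * (taylorCoeff u n * r ^ n) else 0 := by
    intro n
    have e : ∀ t : ℝ, taylorCoeff u n * (r * Complex.exp (Complex.I * t)) ^ n
        * Complex.exp (((j : ℤ) - (i : ℤ) : ℤ) * Complex.I * t)
        = (taylorCoeff u n * r ^ n) *
          Complex.exp (((n + j - i : ℤ) : ℂ) * Complex.I * t) := by
      intro t
      rw [mul_pow, ← Complex.exp_nat_mul, mul_assoc, mul_assoc, ← Complex.exp_add, ← mul_assoc]
      congr 2
      push_cast
      ring
    simp only [e]
    rw [intervalIntegral.integral_const_mul, integral_exp_int_mul]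
    by_cases h : n + j = i
    · rw [if_pos h, if_pos (by omega)]
      ring
    · rw [if_neg h, if_neg (by omega), mul_zero]
  simp only [term] at key
  rw [← key.tsum_eq]
  by_cases hij : j ≤ i
  · rw [tsum_eq_single (i - j) (fun n hn => if_neg (by omega)), if_pos (by omega), if_pos hij]
  · rw [if_neg hij, mul_zero]
    convert tsum_zero with n
    exact if_neg (by omega)

open Finset in
theorem integral_norm_sq_trigPoly (x : ℕ → ℂ) (N : ℕ) :
    ∫ t in (0 : ℝ)..2 * Real.pi, ‖∑ j ∈ range N, x j * Complex.exp (j * Complex.I * t)‖ ^ 2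
      = 2 * Real.pi * ∑ j ∈ range N, ‖x j‖ ^ 2 := by
  have e : ∀ t : ℝ, ((‖∑ j ∈ range N, x j * Complex.exp (j * Complex.I * t)‖ ^ 2 : ℝ) : ℂ)
      = ∑ i ∈ range N, ∑ j ∈ range N, (starRingEnd ℂ) (x i) * x j
          * Complex.exp (((j - i : ℤ) : ℂ) * Complex.I * t) := by
    intro t
    push_cast
    rw [← Complex.conj_mul', map_sum, sum_mul_sum]
    refine sum_congr rfl fun i _ => sum_congr rfl fun j _ => ?_
    rw [map_mul, ← Complex.exp_conj]
    simp only [map_mul, Complex.conj_I, Complex.conj_ofReal, map_natCast]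
    rw [mul_mul_mul_comm, ← Complex.exp_add]
    congr 2
    ring
  apply Complex.ofReal_injective
  rw [← intervalIntegral.integral_ofReal]
  simp only [e]
  rw [intervalIntegral.integral_finsetSum
    fun i _ => Continuous.intervalIntegrable (by fun_prop) _ _]
  rw [Complex.ofReal_mul, Complex.ofReal_sum, mul_sum]
  refine sum_congr rfl fun i hi => ?_
  rw [intervalIntegral.integral_finsetSum
    fun i _ => Continuous.intervalIntegrable (by fun_prop) _ _]
  simp only [intervalIntegral.integral_const_mul, integral_exp_int_mul]
  rw [sum_eq_single i (fun j _ hj => by rw [if_neg (by omega), mul_zero])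
    (fun h => absurd hi h), if_pos (by omega), Complex.conj_mul']
  push_cast
  ring

-- The form is the mean over the circle of u X conj(Y), where X and Y are the trigonometric
-- polynomials with coefficients x and y. Then |u| ≤ 1, |X||Y| ≤ (|X|² + |Y|²)/2 and Parseval apply.
open Finset in
theorem norm_toeplitz_form_le_of_radius {u : ℂ → ℂ} (hu : DifferentiableOn ℂ u (ball 0 1))
    (hb : ∀ z ∈ ball (0 : ℂ) 1, ‖u z‖ ≤ 1) (x y : ℕ → ℂ) (N : ℕ) {r : ℝ}
    (hr0 : 0 ≤ r) (hr1 : r < 1) :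
    ‖∑ i ∈ range N, (starRingEnd ℂ) (y i) *
        ∑ j ∈ range (i + 1), taylorCoeff u (i - j) * r ^ (i - j) * x j‖
      ≤ (∑ j ∈ range N, ‖x j‖ ^ 2 + ∑ i ∈ range N, ‖y i‖ ^ 2) / 2 := by
  have hz : ∀ t : ℝ, (r : ℂ) * Complex.exp (Complex.I * t) ∈ ball (0 : ℂ) 1 := by
    intro t
    simp [Complex.norm_exp, abs_of_nonneg hr0, hr1]
  have hcont : Continuous fun t : ℝ => u (r * Complex.exp (Complex.I * t)) :=
    hu.continuousOn.comp_continuous (by fun_prop) hz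
  set U : ℝ → ℂ := fun t => u (r * Complex.exp (Complex.I * t)) with hU
  have hint : ∀ i j : ℕ, ∫ t in (0 : ℝ)..2 * Real.pi,
      U t * Complex.exp (((j : ℤ) - (i : ℤ) : ℤ) * Complex.I * t)
      = 2 * Real.pi * (if j ≤ i then taylorCoeff u (i - j) * r ^ (i - j) else 0) :=
    integral_mul_exp hu hr0 hr1
  have hUb : ∀ t, ‖U t‖ ≤ 1 := fun t => hb _ (hz t)
  clear_value U
  set X : ℝ → ℂ := fun t => ∑ j ∈ range N, x j * Complex.exp (j * Complex.I * t)
  set Y : ℝ → ℂ := fun t => ∑ j ∈ range N, y j * Complex.exp (j * Complex.I * t)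
  have hX : Continuous X := by fun_prop
  have hY : Continuous Y := by fun_prop
  have eqn : ∫ t in (0 : ℝ)..2 * Real.pi,
      U t * (X t * (starRingEnd ℂ) (Y t))
      = 2 * Real.pi * ∑ i ∈ range N, (starRingEnd ℂ) (y i) *
        ∑ j ∈ range (i + 1), taylorCoeff u (i - j) * r ^ (i - j) * x j := by
    have e : ∀ t : ℝ, U t * (X t * (starRingEnd ℂ) (Y t))
        = ∑ i ∈ range N, ∑ j ∈ range N, (starRingEnd ℂ) (y i) * x j *
          (U t
            * Complex.exp (((j : ℤ) - (i : ℤ) : ℤ) * Complex.I * t)) := by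
      intro t
      simp only [X, Y]
      rw [map_sum, mul_comm (∑ j ∈ range N, _), sum_mul_sum, mul_sum]
      refine sum_congr rfl fun i _ => ?_
      rw [mul_sum]
      refine sum_congr rfl fun j _ => ?_
      rw [map_mul, ← Complex.exp_conj]
      simp only [map_mul, Complex.conj_I, Complex.conj_ofReal, map_natCast]
      rw [mul_mul_mul_comm, ← Complex.exp_add]
      have : (i : ℂ) * -Complex.I * t + j * Complex.I * t
          = (((j : ℤ) - (i : ℤ) : ℤ) : ℂ) * Complex.I * t := by
        push_cast; ring
      rw [this]
      ring
    simp only [e]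
    rw [intervalIntegral.integral_finsetSum
      fun i _ => Continuous.intervalIntegrable (by fun_prop) _ _, mul_sum]
    refine sum_congr rfl fun i hi => ?_
    rw [intervalIntegral.integral_finsetSum
      fun i _ => Continuous.intervalIntegrable (by fun_prop) _ _]
    simp only [intervalIntegral.integral_const_mul, hint]
    have hsub : range (i + 1) ⊆ range N := range_subset_range.2 (mem_range.1 hi)
    rw [mul_sum, mul_sum, ← sum_subset hsub]
    · refine sum_congr rfl fun j hj => ?_
      rw [if_pos (Nat.lt_succ_iff.1 (mem_range.1 hj))]
      ring
    · intro j _ hj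
      rw [if_neg (by simpa [Nat.lt_succ_iff] using hj)]
      simp
  have bound : ‖∫ t in (0 : ℝ)..2 * Real.pi,
      U t * (X t * (starRingEnd ℂ) (Y t))‖
      ≤ ∫ t in (0 : ℝ)..2 * Real.pi, (‖X t‖ ^ 2 + ‖Y t‖ ^ 2) / 2 := by
    refine intervalIntegral.norm_integral_le_of_norm_le (by positivity)
      (Filter.Eventually.of_forall fun t _ => ?_)
      (Continuous.intervalIntegrable (by fun_prop) _ _)
    rw [norm_mul, norm_mul, RCLike.norm_conj]
    have h1 : ‖U t‖ * (‖X t‖ * ‖Y t‖) ≤ 1 * (‖X t‖ * ‖Y t‖) :=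
      mul_le_mul_of_nonneg_right (hUb t) (by positivity)
    nlinarith [sq_nonneg (‖X t‖ - ‖Y t‖)]
  rw [eqn, intervalIntegral.integral_div, intervalIntegral.integral_add
    (Continuous.intervalIntegrable (by fun_prop) _ _)
    (Continuous.intervalIntegrable (by fun_prop) _ _), integral_norm_sq_trigPoly,
    integral_norm_sq_trigPoly, norm_mul] at bound
  have hpi : ‖(2 * Real.pi : ℂ)‖ = 2 * Real.pi := by
    simp [abs_of_pos Real.pi_pos]
  rw [hpi, ← mul_add, mul_div_assoc] at bound
  exact le_of_mul_le_mul_left bound (by positivity)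

open Finset in
/-- The truncated Toeplitz matrices of a function bounded by one are contractions. -/
theorem norm_toeplitz_form_le {u : ℂ → ℂ} (hu : DifferentiableOn ℂ u (ball 0 1))
    (hb : ∀ z ∈ ball (0 : ℂ) 1, ‖u z‖ ≤ 1) (x y : ℕ → ℂ) (N : ℕ) :
    ‖∑ i ∈ range N, (starRingEnd ℂ) (y i) *
        ∑ j ∈ range (i + 1), taylorCoeff u (i - j) * x j‖
      ≤ (∑ j ∈ range N, ‖x j‖ ^ 2 + ∑ i ∈ range N, ‖y i‖ ^ 2) / 2 := by
  -- The function is controlled only inside the disk, so the bound at radius 1 is a limit of those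
  -- at r < 1.
  have hc : Continuous fun r : ℝ => ‖∑ i ∈ range N, (starRingEnd ℂ) (y i) *
        ∑ j ∈ range (i + 1), taylorCoeff u (i - j) * (r : ℂ) ^ (i - j) * x j‖ := by
    fun_prop
  have ht := (hc.tendsto 1).mono_left (nhdsWithin_le_nhds (s := Set.Iio 1))
  simp only [Complex.ofReal_one, one_pow, mul_one] at ht
  refine le_of_tendsto ht ?_
  filter_upwards [Ioo_mem_nhdsLT (zero_lt_one' ℝ)] with r hr
  exact norm_toeplitz_form_le_of_radius hu hb x y N hr.1.le hr.2

open Finset in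
/-- The truncations of multiplication by a function bounded by one are contractions. -/
theorem sum_norm_sq_toeplitz_le {u : ℂ → ℂ} (hu : DifferentiableOn ℂ u (ball 0 1))
    (hb : ∀ z ∈ ball (0 : ℂ) 1, ‖u z‖ ≤ 1) (x : ℕ → ℂ) (N : ℕ) :
    ∑ i ∈ range N, ‖∑ j ∈ range (i + 1), taylorCoeff u (i - j) * x j‖ ^ 2
      ≤ ∑ j ∈ range N, ‖x j‖ ^ 2 := by
  -- Testing against y = Tx makes the form equal to |Tx|², bounded by (|x|² + |Tx|²)/2.
  have h := norm_toeplitz_form_le hu hb x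
    (fun i => ∑ j ∈ range (i + 1), taylorCoeff u (i - j) * x j) N
  simp only [Complex.conj_mul'] at h
  have e : ∀ v : ℕ → ℂ, ‖∑ i ∈ range N, (‖v i‖ : ℂ) ^ 2‖ = ∑ i ∈ range N, ‖v i‖ ^ 2 := by
    intro v
    have : ∑ i ∈ range N, (‖v i‖ : ℂ) ^ 2 = ((∑ i ∈ range N, ‖v i‖ ^ 2 : ℝ) : ℂ) := by
      push_cast; rfl
    rw [this, Complex.norm_real, Real.norm_of_nonneg (by positivity)]
  rw [e] at h
  linarith

/-! ### Carlson's coefficient inequalities -/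

open Finset in
/-- The Toeplitz contraction tested on a vector and its reflection. -/
theorem norm_reflected_form_le {u : ℂ → ℂ} (hu : DifferentiableOn ℂ u (ball 0 1))
    (hb : ∀ z ∈ ball (0 : ℂ) 1, ‖u z‖ ≤ 1) {m : ℕ} (hm : 0 < m) {μ : ℂ} (hμ : ‖μ‖ = 1)
    {w : ℕ → ℂ} (hw : ∀ i, m < 2 * i → w i = 0) :
    ‖taylorCoeff u m + 2 * μ * (∑ i ∈ range (m + 1), (starRingEnd ℂ) (w i) * taylorCoeff u i)
      + μ ^ 2 * ∑ i ∈ range (m + 1), ∑ j ∈ range (i + 1),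
        (starRingEnd ℂ) (w i) * (taylorCoeff u (i - j) * (starRingEnd ℂ) (w (m - j)))‖
      ≤ 1 + ∑ i ∈ range (m + 1), ‖w i‖ ^ 2 := by
  -- Here y = e_m + conj(μ) w, and x is the conjugate of y read backwards, so both have the same
  -- norm. The two cross terms coincide, whence the factor 2; w_m = 0 makes e_m orthogonal to w.
  set y : ℕ → ℂ := fun i => (if i = m then 1 else 0) + (starRingEnd ℂ) μ * w i with hy
  set x : ℕ → ℂ := fun j => (if j = 0 then 1 else 0) + μ * (starRingEnd ℂ) (w (m - j)) with hx
  have h := norm_toeplitz_form_le hu hb x y (m + 1)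
  have hwm : w m = 0 := hw m (by omega)
  have hysum : ∑ i ∈ range (m + 1), ‖y i‖ ^ 2 = 1 + ∑ i ∈ range (m + 1), ‖w i‖ ^ 2 := by
    rw [sum_range_succ, sum_range_succ, add_comm]
    congr 1
    · simp [hy, hwm]
    · simp only [hwm, norm_zero, ne_eq, OfNat.ofNat_ne_zero, not_false_eq_true, zero_pow, add_zero]
      refine sum_congr rfl fun i hi => ?_
      simp [hy, (mem_range.1 hi).ne, hμ]
  have hxsum : ∑ j ∈ range (m + 1), ‖x j‖ ^ 2 = ∑ i ∈ range (m + 1), ‖y i‖ ^ 2 := by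
    rw [← sum_range_reflect]
    refine sum_congr rfl fun j hj => ?_
    have hj' := mem_range.1 hj
    have e : x (m + 1 - 1 - j) = (starRingEnd ℂ) (y j) := by
      simp only [hx, hy, map_add, map_mul, Complex.conj_conj]
      rw [show m - (m + 1 - 1 - j) = j by omega]
      congr 1
      by_cases h : j = m
      · simp [h]
      · rw [if_neg (by omega), if_neg h, map_zero]
    rw [e, RCLike.norm_conj]
  rw [hxsum, hysum, add_self_div_two] at h
  convert h using 2
  have q : ∀ i, ∑ j ∈ range (i + 1), taylorCoeff u (i - j) * x j
      = taylorCoeff u i + μ * ∑ j ∈ range (i + 1),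
        taylorCoeff u (i - j) * (starRingEnd ℂ) (w (m - j)) := by
    intro i
    simp only [hx, mul_add, sum_add_distrib, mul_sum]
    congr 1
    · simp
    · exact sum_congr rfl fun j _ => by ring
  have yq : ∀ v : ℕ → ℂ, ∑ i ∈ range (m + 1), (starRingEnd ℂ) (y i) * v i
      = v m + μ * ∑ i ∈ range (m + 1), (starRingEnd ℂ) (w i) * v i := by
    intro v
    simp only [hy, map_add, map_mul, Complex.conj_conj, add_mul, sum_add_distrib, mul_sum]
    congr 1
    · rw [sum_eq_single m]
      · simp
      · intro i _ hi
        simp [hi]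
      · simp
    · exact sum_congr rfl fun j _ => by ring
  simp only [q]
  rw [yq]
  have hrefl : ∑ j ∈ range (m + 1), taylorCoeff u (m - j) * (starRingEnd ℂ) (w (m - j))
      = ∑ i ∈ range (m + 1), (starRingEnd ℂ) (w i) * taylorCoeff u i := by
    rw [← sum_range_reflect]
    refine sum_congr rfl fun j hj => ?_
    have hj' := mem_range.1 hj
    rw [show m - (m + 1 - 1 - j) = j by omega, mul_comm]
  rw [hrefl]
  simp only [mul_add, sum_add_distrib, mul_sum]
  have e : ∀ i j, (starRingEnd ℂ) (w i) *
      (μ * (taylorCoeff u (i - j) * (starRingEnd ℂ) (w (m - j))))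
      = μ * ((starRingEnd ℂ) (w i) * (taylorCoeff u (i - j) * (starRingEnd ℂ) (w (m - j)))) := by
    intros; ring
  simp only [e, ← mul_sum]
  ring

theorem exists_unimodular_mul_norm (c : ℂ) : ∃ μ : ℂ, ‖μ‖ = 1 ∧ c = μ * ‖c‖ := by
  by_cases hc : c = 0
  · exact ⟨1, by simp, by simp [hc]⟩
  · have : (‖c‖ : ℂ) ≠ 0 := by simpa using hc
    refine ⟨c / ‖c‖, ?_, ?_⟩
    · rw [norm_div, Complex.norm_real, norm_norm, div_self (by simpa using hc)]
    · field_simp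

open Finset in
/-- Carlson's inequality, even index. -/
theorem carlson_even {u : ℂ → ℂ} (hu : DifferentiableOn ℂ u (ball 0 1))
    (hb : ∀ z ∈ ball (0 : ℂ) 1, ‖u z‖ ≤ 1) {n : ℕ} (hn : 0 < n) :
    ‖taylorCoeff u (2 * n)‖ ≤ 1 - ∑ i ∈ range n, ‖taylorCoeff u i‖ ^ 2
      - ‖taylorCoeff u n‖ ^ 2 / (1 + ‖taylorCoeff u 0‖) := by
  obtain ⟨μ, hμ, hc⟩ := exists_unimodular_mul_norm (taylorCoeff u (2 * n))
  set c : ℕ → ℂ := taylorCoeff u with hcdef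
  -- The middle coefficient gets a free weight s, which yields the deficit (2s - s² (1 + |c_0|))
  -- |c_n|². This s maximizes it.
  set s : ℝ := 1 / (1 + ‖c 0‖) with hs
  have hpos : 0 < 1 + ‖c 0‖ := by positivity
  set w : ℕ → ℂ := fun i => if i < n then c i else if i = n then s * c n else 0 with hw
  have h := norm_reflected_form_le hu hb (m := 2 * n) (by omega) hμ (w := w)
    (fun i hi => by simp only [hw]; rw [if_neg (by omega), if_neg (by omega)])
  have split : ∀ v : ℕ → ℝ, (∀ i, n < i → v i = 0) →
      ∑ i ∈ range (2 * n + 1), v i = ∑ i ∈ range n, v i + v n := by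
    intro v hv
    rw [← sum_range_succ, ← sum_subset (range_subset_range.2 (by omega : n + 1 ≤ 2 * n + 1))]
    intro i _ hi
    exact hv i (by simpa [Nat.lt_succ_iff] using hi)
  have w1 : ∀ i ∈ range n, w i = c i := fun i hi => if_pos (mem_range.1 hi)
  have w2 : w n = s * c n := by simp [hw]
  have w3 : ∀ i, n < i → w i = 0 := fun i hi => by
    simp only [hw]; rw [if_neg (by omega), if_neg (by omega)]
  have hs0 : 0 ≤ s := by positivity
  have e1 : ∑ i ∈ range (2 * n + 1), ‖w i‖ ^ 2
      = ∑ i ∈ range n, ‖c i‖ ^ 2 + s ^ 2 * ‖c n‖ ^ 2 := by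
    rw [split _ fun i hi => by simp [w3 i hi], w2, norm_mul, Complex.norm_real,
      Real.norm_of_nonneg hs0, mul_pow, sum_congr rfl fun i hi => by rw [w1 i hi]]
  have e2 : ∑ i ∈ range (2 * n + 1), (starRingEnd ℂ) (w i) * c i
      = ((∑ i ∈ range n, ‖c i‖ ^ 2 + s * ‖c n‖ ^ 2 : ℝ) : ℂ) := by
    have : ∀ i, (starRingEnd ℂ) (w i) * c i
        = ((if i < n then ‖c i‖ ^ 2 else if i = n then s * ‖c n‖ ^ 2 else 0 : ℝ) : ℂ) := by
      intro i
      simp only [hw]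
      split_ifs with h1 h2
      · rw [Complex.conj_mul']; push_cast; rfl
      · subst h2
        rw [map_mul, Complex.conj_ofReal, mul_assoc, Complex.conj_mul']; push_cast; rfl
      · simp
    simp only [this]
    rw [← Complex.ofReal_sum, split]
    · congr 2
      · exact sum_congr rfl fun i hi => if_pos (mem_range.1 hi)
      · simp
    · intro i hi
      rw [if_neg (by omega), if_neg (by omega)]
  -- A nonzero term needs i ≤ n, 2n - j ≤ n and j ≤ i, hence i = j = n.
  have e3 : ∑ i ∈ range (2 * n + 1), ∑ j ∈ range (i + 1),
        (starRingEnd ℂ) (w i) * (c (i - j) * (starRingEnd ℂ) (w (2 * n - j)))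
      = (starRingEnd ℂ) (w n) * (c 0 * (starRingEnd ℂ) (w n)) := by
    rw [sum_eq_single n, sum_eq_single n]
    · simp only [Nat.sub_self, show 2 * n - n = n by omega]
    · intro j hj hjn
      rw [w3 (2 * n - j) (by have := mem_range.1 hj; omega)]
      simp
    · simp
    · intro i _ hin
      refine sum_eq_zero fun j hj => ?_
      have := mem_range.1 hj
      rcases lt_or_gt_of_ne hin with h1 | h1
      · rw [w3 (2 * n - j) (by omega)]
        simp
      · rw [w3 i h1]
        simp
    · intro h
      exact absurd (mem_range.2 (by omega)) h
  rw [e1, e2, e3] at h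
  set S := ∑ i ∈ range n, ‖c i‖ ^ 2 with hS
  have hS0 : 0 ≤ S := sum_nonneg fun i _ => by positivity
  have h3 : ‖μ ^ 2 * ((starRingEnd ℂ) (w n) * (c 0 * (starRingEnd ℂ) (w n)))‖
      = s ^ 2 * ‖c n‖ ^ 2 * ‖c 0‖ := by
    rw [w2]
    simp only [norm_mul, norm_pow, RCLike.norm_conj, Complex.norm_real,
      Real.norm_of_nonneg hs0, hμ]
    ring
  have h4 : ‖c (2 * n) + 2 * μ * ((S + s * ‖c n‖ ^ 2 : ℝ) : ℂ)‖
      = ‖c (2 * n)‖ + 2 * (S + s * ‖c n‖ ^ 2) := by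
    have : c (2 * n) + 2 * μ * ((S + s * ‖c n‖ ^ 2 : ℝ) : ℂ)
        = μ * ((‖c (2 * n)‖ + 2 * (S + s * ‖c n‖ ^ 2) : ℝ) : ℂ) := by
      conv_lhs => rw [hc]
      push_cast
      ring
    rw [this, norm_mul, hμ, one_mul, Complex.norm_real, Real.norm_of_nonneg (by positivity)]
  have h5 := (norm_sub_le_norm_add _ _).trans h
  rw [h3, h4] at h5
  have h6 : ‖c n‖ ^ 2 / (1 + ‖c 0‖) = s * ‖c n‖ ^ 2 := by rw [hs]; ring
  have h7 : s ^ 2 * ‖c n‖ ^ 2 * ‖c 0‖ + s ^ 2 * ‖c n‖ ^ 2 = s * ‖c n‖ ^ 2 := by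
    rw [hs]; field_simp; ring
  rw [h6]
  linarith

open Finset in
/-- Carlson's inequality, odd index. -/
theorem carlson_odd {u : ℂ → ℂ} (hu : DifferentiableOn ℂ u (ball 0 1))
    (hb : ∀ z ∈ ball (0 : ℂ) 1, ‖u z‖ ≤ 1) (n : ℕ) :
    ‖taylorCoeff u (2 * n + 1)‖ ≤ 1 - ∑ i ∈ range (n + 1), ‖taylorCoeff u i‖ ^ 2 := by
  obtain ⟨μ, hμ, hc⟩ := exists_unimodular_mul_norm (taylorCoeff u (2 * n + 1))
  set c : ℕ → ℂ := taylorCoeff u with hcdef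
  set w : ℕ → ℂ := fun i => if i < n + 1 then c i else 0 with hw
  have w1 : ∀ i ∈ range (n + 1), w i = c i := fun i hi => if_pos (mem_range.1 hi)
  have w3 : ∀ i, n + 1 ≤ i → w i = 0 := fun i hi => if_neg (by omega)
  have h := norm_reflected_form_le hu hb (m := 2 * n + 1) (by omega) hμ (w := w)
    (fun i hi => w3 i (by omega))
  have e1 : ∑ i ∈ range (2 * n + 1 + 1), ‖w i‖ ^ 2 = ∑ i ∈ range (n + 1), ‖c i‖ ^ 2 := by
    rw [← sum_subset (range_subset_range.2 (by omega : n + 1 ≤ 2 * n + 1 + 1))]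
    · exact sum_congr rfl fun i hi => by rw [w1 i hi]
    · intro i _ hi
      simp [w3 i (by simpa using hi)]
  have e2 : ∑ i ∈ range (2 * n + 1 + 1), (starRingEnd ℂ) (w i) * c i
      = ((∑ i ∈ range (n + 1), ‖c i‖ ^ 2 : ℝ) : ℂ) := by
    rw [← sum_subset (range_subset_range.2 (by omega : n + 1 ≤ 2 * n + 1 + 1)),
      Complex.ofReal_sum]
    · exact sum_congr rfl fun i hi => by rw [w1 i hi, Complex.conj_mul']; push_cast; rfl
    · intro i _ hi
      simp [w3 i (by simpa using hi)]
  -- A nonzero term would need i ≤ n < j together with j ≤ i; with an odd index there is no middle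
  -- term.
  have e3 : ∑ i ∈ range (2 * n + 1 + 1), ∑ j ∈ range (i + 1),
        (starRingEnd ℂ) (w i) * (c (i - j) * (starRingEnd ℂ) (w (2 * n + 1 - j))) = 0 := by
    refine sum_eq_zero fun i _ => sum_eq_zero fun j hj => ?_
    have := mem_range.1 hj
    by_cases hi : n + 1 ≤ i
    · rw [w3 i hi]
      simp
    · rw [w3 (2 * n + 1 - j) (by omega)]
      simp
  rw [e1, e2, e3, mul_zero, add_zero] at h
  set S := ∑ i ∈ range (n + 1), ‖c i‖ ^ 2 with hS
  have hS0 : 0 ≤ S := sum_nonneg fun i _ => by positivity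
  have h4 : ‖c (2 * n + 1) + 2 * μ * (S : ℂ)‖ = ‖c (2 * n + 1)‖ + 2 * S := by
    have : c (2 * n + 1) + 2 * μ * (S : ℂ)
        = μ * ((‖c (2 * n + 1)‖ + 2 * S : ℝ) : ℂ) := by
      conv_lhs => rw [hc]
      push_cast
      ring
    rw [this, norm_mul, hμ, one_mul, Complex.norm_real, Real.norm_of_nonneg (by positivity)]
  rw [h4] at h
  linarith

open Finset in
/-- Coefficients of positive index of a function bounded by one. -/
theorem norm_taylorCoeff_le {u : ℂ → ℂ} (hu : DifferentiableOn ℂ u (ball 0 1))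
    (hb : ∀ z ∈ ball (0 : ℂ) 1, ‖u z‖ ≤ 1) {m : ℕ} (hm : 0 < m) :
    ‖taylorCoeff u m‖ ≤ 1 - ‖taylorCoeff u 0‖ ^ 2 := by
  have hle : ∀ n, 0 < n →
      ‖taylorCoeff u 0‖ ^ 2 ≤ ∑ i ∈ range n, ‖taylorCoeff u i‖ ^ 2 := fun n hn =>
    single_le_sum (f := fun i => ‖taylorCoeff u i‖ ^ 2) (fun i _ => by positivity)
      (mem_range.2 hn)
  rcases Nat.even_or_odd' m with ⟨n, rfl | rfl⟩
  · have h1 := carlson_even hu hb (n := n) (by omega)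
    have h2 : 0 ≤ ‖taylorCoeff u n‖ ^ 2 / (1 + ‖taylorCoeff u 0‖) := by positivity
    linarith [hle n (by omega)]
  · linarith [carlson_odd hu hb n, hle (n + 1) (by omega)]

/-! ### Taylor coefficients of derivatives and products; bounded quotients -/

theorem taylorCoeff_zero (u : ℂ → ℂ) : taylorCoeff u 0 = u 0 := by
  simp [taylorCoeff]

theorem taylorCoeff_deriv (u : ℂ → ℂ) (n : ℕ) :
    taylorCoeff (deriv u) n = (n + 1) * taylorCoeff u (n + 1) := by
  rw [taylorCoeff, taylorCoeff, ← iteratedDeriv_succ', Nat.factorial_succ]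
  have h1 : ((n : ℂ) + 1) ≠ 0 := by exact_mod_cast n.succ_ne_zero
  have h2 : (n.factorial : ℂ) ≠ 0 := by exact_mod_cast n.factorial_ne_zero
  push_cast
  field_simp

open Finset in
theorem taylorCoeff_mul {u v : ℂ → ℂ} (hu : AnalyticAt ℂ u 0) (hv : AnalyticAt ℂ v 0) (n : ℕ) :
    taylorCoeff (fun z => u z * v z) n
      = ∑ j ∈ range (n + 1), taylorCoeff u (n - j) * taylorCoeff v j := by
  have h := iteratedDeriv_mul (n := n) (x := 0) hu.contDiffAt hv.contDiffAt
  have e : (fun z => u z * v z) = u * v := rfl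
  rw [taylorCoeff, e, h, ← sum_range_reflect, sum_div]
  refine sum_congr rfl fun j hj => ?_
  have hj' : j ≤ n := Nat.lt_succ_iff.1 (mem_range.1 hj)
  have e1 : n + 1 - 1 - j = n - j := by omega
  rw [e1, show n - (n - j) = j by omega, taylorCoeff, taylorCoeff, Nat.choose_symm hj',
    Nat.cast_choose ℂ hj']
  have h0 : (n.factorial : ℂ) ≠ 0 := by exact_mod_cast n.factorial_ne_zero
  field_simp

theorem taylorCoeff_congr {u v : ℂ → ℂ} (h : ∀ z ∈ ball (0 : ℂ) 1, u z = v z) (n : ℕ) :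
    taylorCoeff u n = taylorCoeff v n := by
  rw [taylorCoeff, taylorCoeff, Filter.EventuallyEq.iteratedDeriv_eq n]
  filter_upwards [ball_mem_nhds (0 : ℂ) one_pos] with z hz using h z hz

/-- A quotient of analytic functions that is bounded by one off the zeros of the denominator
extends analytically. -/
theorem exists_bounded_quotient {u v : ℂ → ℂ} (hu : DifferentiableOn ℂ u (ball 0 1))
    (hv : DifferentiableOn ℂ v (ball 0 1)) (hle : ∀ z ∈ ball (0 : ℂ) 1, ‖u z‖ ≤ ‖v z‖) :
    ∃ φ : ℂ → ℂ, DifferentiableOn ℂ φ (ball 0 1) ∧ (∀ z ∈ ball (0 : ℂ) 1, ‖φ z‖ ≤ 1) ∧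
      ∀ z ∈ ball (0 : ℂ) 1, u z = φ z * v z := by
  by_cases hne : ∃ z ∈ ball (0 : ℂ) 1, v z ≠ 0
  swap
  · push Not at hne
    refine ⟨fun _ => 0, differentiableOn_const 0, by simp, fun z hz => ?_⟩
    rw [zero_mul, ← norm_le_zero_iff, ← norm_zero (E := ℂ), ← hne z hz]
    exact hle z hz
  have hua := hu.analyticOnNhd isOpen_ball
  have hva := hv.analyticOnNhd isOpen_ball
  have hnz : ∀ z ∈ ball (0 : ℂ) 1, ∀ᶠ x in nhdsWithin z {z}ᶜ, v x ≠ 0 := by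
    intro z hz
    rcases (hva z hz).eventually_eq_zero_or_eventually_ne_zero with h | h
    · obtain ⟨z₁, hz₁, hn⟩ := hne
      exact absurd (hva.eqOn_zero_of_preconnected_of_eventuallyEq_zero
        (convex_ball 0 1).isPreconnected hz h hz₁) hn
    · exact h
  have hball : ∀ z ∈ ball (0 : ℂ) 1, ∀ᶠ x in nhdsWithin z {z}ᶜ, x ∈ ball (0 : ℂ) 1 :=
    fun z hz => nhdsWithin_le_nhds (isOpen_ball.mem_nhds hz)
  set q : ℂ → ℂ := fun z => u z / v z with hq
  have hm : MeromorphicOn q (ball 0 1) := fun z hz =>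
    (hua z hz).meromorphicAt.div (hva z hz).meromorphicAt
  -- Division by zero gives `q` the value 0 at the zeros of `v`, so the bound holds there too.
  have hqb : ∀ z ∈ ball (0 : ℂ) 1, ‖q z‖ ≤ 1 := by
    intro z hz
    rw [hq, norm_div]
    exact div_le_one_of_le₀ (hle z hz) (norm_nonneg _)
  set φ := toMeromorphicNFOn q (ball 0 1) with hφ
  have heq : ∀ z ∈ ball (0 : ℂ) 1, ∀ᶠ x in nhdsWithin z {z}ᶜ, q x = φ x := fun z hz =>
    (hm.toMeromorphicNFOn_eq_self_on_nhdsNE hz).symm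
  have han : ∀ z ∈ ball (0 : ℂ) 1, AnalyticAt ℂ φ z := by
    intro z hz
    have hnf : MeromorphicNFAt φ z := meromorphicNFOn_toMeromorphicNFOn _ _ hz
    -- A negative order would make |q| tend to infinity at z, against |q| ≤ 1.
    rw [← hnf.meromorphicOrderAt_nonneg_iff_analyticAt, hφ,
      meromorphicOrderAt_toMeromorphicNFOn hm hz]
    by_contra hlt
    have ht := tendsto_norm_cobounded_atTop.comp
      (tendsto_cobounded_of_meromorphicOrderAt_neg (not_le.1 hlt))
    obtain ⟨x, hx1, hx2⟩ := ((ht.eventually_gt_atTop 1).and (hball z hz)).exists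
    exact absurd hx1 (not_lt.2 (hqb x hx2))
  refine ⟨φ, fun z hz => (han z hz).differentiableAt.differentiableWithinAt, fun z hz => ?_,
    fun z hz => ?_⟩
  · have ht : Filter.Tendsto (fun x => ‖φ x‖) (nhdsWithin z {z}ᶜ) (nhds ‖φ z‖) :=
      ((han z hz).continuousAt.norm).tendsto.mono_left nhdsWithin_le_nhds
    refine le_of_tendsto ht ?_
    filter_upwards [heq z hz, hball z hz] with x h1 h2
    rw [← h1]
    exact hqb x h2
  · have h1 : Filter.Tendsto u (nhdsWithin z {z}ᶜ) (nhds (u z)) :=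
      (hua z hz).continuousAt.tendsto.mono_left nhdsWithin_le_nhds
    have h2 : Filter.Tendsto (fun x => φ x * v x) (nhdsWithin z {z}ᶜ) (nhds (φ z * v z)) :=
      ((han z hz).continuousAt.mul (hva z hz).continuousAt).tendsto.mono_left nhdsWithin_le_nhds
    refine tendsto_nhds_unique (h1.congr' ?_) h2
    filter_upwards [heq z hz, hnz z hz] with x h1 h2
    rw [← h1, hq]
    exact (div_mul_cancel₀ _ h2).symm

/-! ### Bounds for the majorant series of `h` and `g` -/

theorem taylorCoeff_sub_const (u : ℂ → ℂ) (c : ℂ) (n : ℕ) :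
    taylorCoeff (fun z => u z - c) (n + 1) = taylorCoeff u (n + 1) := by
  have h : (n : ℂ) + 1 ≠ 0 := by exact_mod_cast n.succ_ne_zero
  have e : deriv (fun z => u z - c) = deriv u := funext fun z => deriv_sub_const c
  have h1 := taylorCoeff_deriv (fun z => u z - c) n
  rw [e, taylorCoeff_deriv] at h1
  exact (mul_left_cancel₀ h h1).symm

theorem normSqR_sub_const (u : ℂ → ℂ) (c : ℂ) (r : ℝ) :
    normSqR (fun z => u z - c) r = normSqR u r := by
  simp only [normSqR, taylorCoeff_sub_const]

open Finset in
/-- The refined Bohr inequality, with the gain coming from the first coefficient. -/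
theorem refined_bohr {h : ℂ → ℂ} (hh : DifferentiableOn ℂ h (ball 0 1))
    (hb : ∀ z ∈ ball (0 : ℂ) 1, ‖h z‖ ≤ 1) {r : ℝ} (hr0 : 0 ≤ r) (hr1 : r < 1) :
    majorant h r + 1 / (1 + ‖h 0‖) * ((1 + ‖h 0‖ * r) / (1 - r)) * normSqR h r
      ≤ (1 - ‖h 0‖ ^ 2) * (r / (1 - r)) - (1 - ‖h 0‖ ^ 2 - ‖taylorCoeff h 1‖) * r := by
  set a := ‖h 0‖ with ha
  have ha0 : ‖taylorCoeff h 0‖ = a := by rw [taylorCoeff_zero]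
  have ha1 : a ≤ 1 := hb 0 (by simp)
  have h1r : 0 < 1 - r := by linarith
  have hodd : ∀ n, ‖taylorCoeff h (2 * n + 1)‖
      ≤ 1 - a ^ 2 - ∑ j ∈ range n, ‖taylorCoeff h (j + 1)‖ ^ 2 := by
    intro n
    have := carlson_odd hh hb n
    rw [sum_range_succ', ha0] at this
    linarith
  have heven : ∀ n, ‖taylorCoeff h (2 * n + 1 + 1)‖
      ≤ 1 - a ^ 2 - ∑ j ∈ range n, ‖taylorCoeff h (j + 1)‖ ^ 2
        - ‖taylorCoeff h (n + 1)‖ ^ 2 / (1 + a) := by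
    intro n
    have := carlson_even hh hb n.succ_pos
    rw [sum_range_succ', ha0] at this
    rw [show 2 * n + 1 + 1 = 2 * n.succ by omega]
    linarith
  have fin := refined_bohr_finite (x := fun n => ‖taylorCoeff h (n + 1)‖) (norm_nonneg _) hr0 hr1
    hodd heven
  have hM := (summable_majorant hh hr0 hr1).hasSum.tendsto_sum_nat
  have hN := (summable_normSqR hh hr0 hr1).hasSum.tendsto_sum_nat
  have hidx : Filter.Tendsto (fun K : ℕ => 2 * K + 1) Filter.atTop Filter.atTop :=
    Filter.tendsto_atTop_mono (fun K => by omega : ∀ K : ℕ, K ≤ 2 * K + 1) Filter.tendsto_id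
  have hidx' : Filter.Tendsto (fun K : ℕ => 2 * K + 2) Filter.atTop Filter.atTop :=
    Filter.tendsto_atTop_mono (fun K => by omega : ∀ K : ℕ, K ≤ 2 * K + 2) Filter.tendsto_id
  have hR := ((((tendsto_pow_atTop_nhds_zero_of_lt_one hr0 hr1).comp hidx').div_const
    (1 - r)).const_add ((1 - a ^ 2) * (r / (1 - r)) - (1 - a ^ 2 - ‖taylorCoeff h 1‖) * r))
  rw [zero_div, add_zero] at hR
  refine le_of_tendsto_of_tendsto' ((hM.comp hidx).add (hN.const_mul _)) hR fun K => ?_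
  refine (fin K).trans ?_
  -- Any bound on these sums uniform in K makes the boundary term with r^(2K+2) vanish in the limit.
  have hS : ∑ n ∈ range K, ‖taylorCoeff h (n + 1)‖ ^ 2 ≤ 1 := by
    have := hodd K
    nlinarith [norm_nonneg (taylorCoeff h (2 * K + 1)), sq_nonneg a]
  have hA : 0 ≤ 1 - a ^ 2 := by nlinarith [norm_nonneg (h 0)]
  have hq : 0 ≤ r ^ (2 * K + 2) / (1 - r) := by positivity
  have h1 := mul_le_mul_of_nonneg_right hS hq
  have h2 := mul_nonneg hA hq
  simp only [Function.comp]
  rw [sub_div, mul_sub]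
  simp only [zero_add]
  linarith

open Finset in
theorem taylorCoeff_of_deriv_eq {k : ℝ} {g h φ : ℂ → ℂ} (hh : DifferentiableOn ℂ h (ball 0 1))
    (hφ : DifferentiableOn ℂ φ (ball 0 1))
    (hd : ∀ z ∈ ball (0 : ℂ) 1, deriv g z = φ z * (k * deriv h z)) (n : ℕ) :
    (n + 1) * taylorCoeff g (n + 1)
      = k * ∑ j ∈ range (n + 1), taylorCoeff φ (n - j) * ((j + 1) * taylorCoeff h (j + 1)) := by
  have h0 : (0 : ℂ) ∈ ball (0 : ℂ) 1 := by simp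
  have hda : AnalyticAt ℂ (deriv h) 0 := (hh.analyticOnNhd isOpen_ball 0 h0).deriv
  rw [← taylorCoeff_deriv, taylorCoeff_congr hd,
    taylorCoeff_mul (hφ.analyticOnNhd isOpen_ball 0 h0) (analyticAt_const.fun_mul hda), mul_sum]
  refine sum_congr rfl fun j _ => ?_
  have : taylorCoeff (fun z => (k : ℂ) * deriv h z) j = k * taylorCoeff (deriv h) j := by
    rw [taylorCoeff, iteratedDeriv_const_mul_field, taylorCoeff, mul_div_assoc]
  rw [this, taylorCoeff_deriv]
  ring

open Finset in
/-- Comparison of majorant series for `r ≤ 1 / 2`. -/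
theorem majorant_le_of_deriv_eq {k : ℝ} (hk : 0 ≤ k) {g h φ : ℂ → ℂ}
    (hh : DifferentiableOn ℂ h (ball 0 1)) (hb : ∀ z ∈ ball (0 : ℂ) 1, ‖h z‖ ≤ 1)
    (hφ : DifferentiableOn ℂ φ (ball 0 1)) (hφb : ∀ z ∈ ball (0 : ℂ) 1, ‖φ z‖ ≤ 1)
    (hd : ∀ z ∈ ball (0 : ℂ) 1, deriv g z = φ z * (k * deriv h z))
    {r : ℝ} (hr0 : 0 ≤ r) (hr : r ≤ 1 / 2) :
    majorant g r ≤ k * (majorant h r + (1 - ‖h 0‖ ^ 2 - ‖taylorCoeff h 1‖) * r) := by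
  set A := 1 - ‖h 0‖ ^ 2 with hA
  set x : ℕ → ℝ := fun n => ‖taylorCoeff h (n + 1)‖ with hx
  set β := ‖taylorCoeff φ 0‖ with hβ
  have hx0 : ∀ n, 0 ≤ x n := fun n => norm_nonneg _
  have hxA : ∀ n, x n ≤ A := fun n => by
    have := norm_taylorCoeff_le hh hb n.succ_pos
    rwa [taylorCoeff_zero] at this
  have hβ0 : 0 ≤ β := norm_nonneg _
  have hβ1 : β ≤ 1 := by
    rw [hβ, taylorCoeff_zero]
    exact hφb 0 (by simp)
  -- In the Cauchy product for g' = k φ h', the constant coefficient of φ contributes β, and all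
  -- others are at most 1 - β².
  have hcoef : ∀ n, ‖taylorCoeff g (n + 1)‖ * r ^ (n + 1)
      ≤ k * (β * (x n * r ^ (n + 1)) + (1 - β ^ 2) / 2 *
        (2 * r ^ (n + 1) * (∑ j ∈ range n, ((j : ℝ) + 1) * x j) / (n + 1))) := by
    intro n
    have hn : (0 : ℝ) < n + 1 := by positivity
    have h1 : ((n : ℝ) + 1) * ‖taylorCoeff g (n + 1)‖
        ≤ k * (β * ((n + 1) * x n) + (1 - β ^ 2) * ∑ j ∈ range n, ((j : ℝ) + 1) * x j) := by
      have hnorm : ∀ m : ℕ, ‖(m : ℂ) + 1‖ = (m : ℝ) + 1 := fun m => by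
        exact_mod_cast Complex.norm_natCast (m + 1)
      have := congrArg norm (taylorCoeff_of_deriv_eq hh hφ hd n)
      rw [norm_mul, norm_mul, hnorm, Complex.norm_real, Real.norm_of_nonneg hk] at this
      rw [this]
      refine mul_le_mul_of_nonneg_left ((norm_sum_le _ _).trans ?_) hk
      rw [sum_range_succ, add_comm]
      simp only [norm_mul, hnorm, Nat.sub_self]
      refine add_le_add le_rfl ?_
      rw [mul_sum]
      refine sum_le_sum fun j hj => mul_le_mul_of_nonneg_right ?_ (by positivity)
      exact norm_taylorCoeff_le hφ hφb (Nat.sub_pos_of_lt (mem_range.1 hj))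
    have h2 := mul_le_mul_of_nonneg_right h1 (by positivity : 0 ≤ r ^ (n + 1) / (n + 1))
    have e1 : ((n : ℝ) + 1) * ‖taylorCoeff g (n + 1)‖ * (r ^ (n + 1) / (n + 1))
        = ‖taylorCoeff g (n + 1)‖ * r ^ (n + 1) := by
      field_simp
    rw [e1] at h2
    refine h2.trans (le_of_eq ?_)
    field_simp
  have hsum := summable_majorant hh hr0 (by linarith : r < 1)
  have hg0 : ∀ n, 0 ≤ ‖taylorCoeff g (n + 1)‖ * r ^ (n + 1) := fun n => by positivity
  refine Real.tsum_le_of_sum_range_le hg0 fun M => ?_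
  calc ∑ n ∈ range M, ‖taylorCoeff g (n + 1)‖ * r ^ (n + 1)
      ≤ ∑ n ∈ range (M + 2), ‖taylorCoeff g (n + 1)‖ * r ^ (n + 1) :=
        sum_le_sum_of_subset_of_nonneg (range_subset_range.2 (by omega)) fun n _ _ => hg0 n
    _ ≤ _ := sum_le_sum fun n _ => hcoef n
    _ ≤ k * (majorant h r + (A - x 0) * r) := ?_
  rw [← mul_sum, sum_add_distrib, ← mul_sum, ← mul_sum]
  refine mul_le_mul_of_nonneg_left ?_ hk
  have hW := averaged_series_le hx0 hxA hr0 hr M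
  have hX : ∑ n ∈ range (M + 2), x n * r ^ (n + 1) ≤ majorant h r :=
    hsum.sum_le_tsum _ fun n _ => by positivity
  have hW0 : 0 ≤ ∑ n ∈ range (M + 2),
      2 * r ^ (n + 1) * (∑ j ∈ range n, ((j : ℝ) + 1) * x j) / (n + 1) :=
    sum_nonneg fun n _ => by positivity
  have hAx : 0 ≤ (A - x 0) * r := mul_nonneg (sub_nonneg.2 (hxA 0)) hr0
  generalize ∑ n ∈ range (M + 2),
      2 * r ^ (n + 1) * (∑ j ∈ range n, ((j : ℝ) + 1) * x j) / (n + 1) = W at *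
  generalize ∑ n ∈ range (M + 2), x n * r ^ (n + 1) = X at *
  -- As (1 + β)/2 ≤ 1, the bound becomes the convex combination β X + (1 - β)((A - x_0) r + X), at
  -- most X + (A - x_0) r.
  have e1 : (1 - β ^ 2) / 2 * W ≤ (1 - β) * W :=
    mul_le_mul_of_nonneg_right (by nlinarith) hW0
  have e2 : (1 - β) * W ≤ (1 - β) * ((A - x 0) * r + X) :=
    mul_le_mul_of_nonneg_left hW (by linarith)
  nlinarith

open Finset in
/-- Comparison of quadratic majorant series. -/
theorem normSqR_le_of_deriv_eq {k : ℝ} (hk : 0 ≤ k) {g h φ : ℂ → ℂ}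
    (hh : DifferentiableOn ℂ h (ball 0 1))
    (hφ : DifferentiableOn ℂ φ (ball 0 1)) (hφb : ∀ z ∈ ball (0 : ℂ) 1, ‖φ z‖ ≤ 1)
    (hd : ∀ z ∈ ball (0 : ℂ) 1, deriv g z = φ z * (k * deriv h z))
    {r : ℝ} (hr0 : 0 ≤ r) (hr1 : r < 1) :
    normSqR g r ≤ k ^ 2 * normSqR h r := by
  set X : ℕ → ℂ := fun j => ((j : ℂ) + 1) * taylorCoeff h (j + 1) with hX
  set Y : ℕ → ℂ := fun n => ∑ j ∈ range (n + 1), taylorCoeff φ (n - j) * X j with hY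
  have hnorm : ∀ m : ℕ, ‖(m : ℂ) + 1‖ = (m : ℝ) + 1 := fun m => by
    exact_mod_cast Complex.norm_natCast (m + 1)
  have hYg : ∀ n : ℕ, ((n : ℝ) + 1) * ‖taylorCoeff g (n + 1)‖ = k * ‖Y n‖ := fun n => by
    have := congrArg norm (taylorCoeff_of_deriv_eq hh hφ hd n)
    rwa [norm_mul, norm_mul, hnorm, Complex.norm_real, Real.norm_of_nonneg hk] at this
  have hXh : ∀ n : ℕ, ((n : ℝ) + 1) * ‖taylorCoeff h (n + 1)‖ = ‖X n‖ := fun n => by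
    rw [hX, norm_mul, hnorm]
  -- `X` and kY are the coefficients of h' and g'. These decreasing weights undo the
  -- differentiation, so the contraction bound on prefix sums passes to `h` and `g`.
  set w : ℕ → ℝ := fun n => r ^ (2 * (n + 1)) / ((n : ℝ) + 1) ^ 2 with hw
  have hanti : Antitone w := by
    refine antitone_nat_of_succ_le fun n => ?_
    refine div_le_div₀ (by positivity) (pow_le_pow_of_le_one hr0 hr1.le (by omega))
      (by positivity) ?_
    push_cast
    gcongr
    linarith
  have hpre : ∀ N, 0 ≤ ∑ n ∈ range N, (‖X n‖ ^ 2 - ‖Y n‖ ^ 2) := fun N => by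
    rw [sum_sub_distrib, sub_nonneg]
    exact sum_norm_sq_toeplitz_le hφ hφb X N
  have hsum := summable_normSqR hh hr0 hr1
  refine Real.tsum_le_of_sum_range_le (fun n => by positivity) fun N => ?_
  have hab := sum_mul_nonneg_of_prefix_nonneg hanti hpre N
  have hpos : 0 ≤ w N * ∑ n ∈ range N, (‖X n‖ ^ 2 - ‖Y n‖ ^ 2) :=
    mul_nonneg (by positivity) (hpre N)
  have hterm : ∀ n, w n * (‖X n‖ ^ 2 - ‖Y n‖ ^ 2) * k ^ 2
      = k ^ 2 * (‖taylorCoeff h (n + 1)‖ ^ 2 * r ^ (2 * (n + 1)))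
        - ‖taylorCoeff g (n + 1)‖ ^ 2 * r ^ (2 * (n + 1)) := fun n => by
    have e : (‖X n‖ ^ 2 - ‖Y n‖ ^ 2) * k ^ 2 = ‖X n‖ ^ 2 * k ^ 2 - (k * ‖Y n‖) ^ 2 := by ring
    rw [mul_assoc, e, ← hYg, ← hXh, hw]
    field_simp
  have h1 := mul_nonneg (hpos.trans hab) (sq_nonneg k)
  rw [sum_mul, sum_congr rfl fun n _ => hterm n, sum_sub_distrib, ← mul_sum] at h1
  have h2 : ∑ n ∈ range N, ‖taylorCoeff h (n + 1)‖ ^ 2 * r ^ (2 * (n + 1)) ≤ normSqR h r :=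
    hsum.sum_le_tsum _ fun n _ => by positivity
  have h3 := mul_le_mul_of_nonneg_left h2 (sq_nonneg k)
  linarith

theorem cCoeff_mul_sq (k : ℝ) : cCoeff k * k ^ 2 = k := by
  unfold cCoeff
  split_ifs with h
  · simp [h]
  · field_simp

theorem cCoeff_nonneg {k : ℝ} (hk : 0 ≤ k) : 0 ≤ cCoeff k := by
  unfold cCoeff
  split_ifs
  · exact le_rfl
  · positivity

/-- The Bohr-type bound for the class `H_k`, valid for all `r ≤ 1 / 2`. -/
theorem bohrE_le {k : ℝ} (hk : 0 ≤ k) {f h g : ℂ → ℂ} (hf : IsInHk k f h g) {r : ℝ}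
    (hr0 : 0 ≤ r) (hr : r ≤ 1 / 2) :
    bohrE k h g r ≤ (1 + k) * ((1 - ‖h 0‖ ^ 2) * (r / (1 - r))) := by
  have hr1 : r < 1 := by linarith
  have hh := hf.analytic_h
  have hb := hf.norm_h_le
  -- Dividing by k h' instead of h' normalizes |φ| ≤ 1 and covers k = 0.
  obtain ⟨φ, hφ, hφb, hd⟩ := exists_bounded_quotient
    (u := deriv g) (v := fun z => (k : ℂ) * deriv h z)
    (hf.analytic_g.deriv isOpen_ball) ((hh.deriv isOpen_ball).const_mul _)
    (fun z hz => by
      rw [norm_mul, Complex.norm_real, Real.norm_of_nonneg hk]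
      exact hf.norm_deriv_le z hz)
  have h1 := refined_bohr hh hb hr0 hr1
  have h2 := majorant_le_of_deriv_eq hk hh hb hφ hφb hd hr0 hr
  have h3 := normSqR_le_of_deriv_eq hk hh hφ hφb hd hr0 hr1
  have h4 := norm_taylorCoeff_le hh hb one_pos
  rw [taylorCoeff_zero] at h4
  have h5 : cCoeff k * normSqR g r ≤ k * normSqR h r := by
    calc _ ≤ cCoeff k * (k ^ 2 * normSqR h r) :=
          mul_le_mul_of_nonneg_left h3 (cCoeff_nonneg hk)
      _ = k * normSqR h r := by rw [← mul_assoc, cCoeff_mul_sq]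
  unfold bohrE
  rw [normSqR_sub_const]
  have hC : 0 ≤ 1 / (1 + ‖h 0‖) * ((1 + ‖h 0‖ * r) / (1 - r)) := by
    have : 0 < 1 - r := by linarith
    positivity
  have h6 := mul_le_mul_of_nonneg_left h5 hC
  have h7 := mul_le_mul_of_nonneg_left h1 (by linarith : 0 ≤ 1 + k)
  have h8 : 0 ≤ (1 - ‖h 0‖ ^ 2 - ‖taylorCoeff h 1‖) * r :=
    mul_nonneg (by linarith) hr0
  nlinarith

/-- If |h(0)| = 1, the bound |a_n| ≤ 1 - |a_0|² kills every higher coefficient. -/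
theorem norm_zero_lt_one {h : ℂ → ℂ} (hh : DifferentiableOn ℂ h (ball 0 1))
    (hb : ∀ z ∈ ball (0 : ℂ) 1, ‖h z‖ ≤ 1) (hn : NonconstOnDisk h) : ‖h 0‖ < 1 := by
  by_contra hlt
  obtain ⟨z, hz, hne⟩ := hn
  have hc : ∀ n, n ≠ 0 → taylorCoeff h n * z ^ n = 0 := fun n hn => by
    have := norm_taylorCoeff_le hh hb (Nat.pos_of_ne_zero hn)
    rw [taylorCoeff_zero] at this
    have h0 : ‖taylorCoeff h n‖ ≤ 0 := by nlinarith
    rw [norm_le_zero_iff.1 h0, zero_mul]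
  refine hne ((hasSum_taylorCoeff hh hz).unique ?_)
  convert hasSum_single 0 hc using 1
  simp [taylorCoeff_zero]

/-! ### The radius r_k^p(a) -/

section Radius

variable {k p a : ℝ}

theorem one_sub_rpow_pos (hp : 0 < p) (ha0 : 0 ≤ a) (ha1 : a < 1) : 0 < 1 - a ^ p :=
  sub_pos.2 (Real.rpow_lt_one ha0 ha1 hp)

theorem mul_one_sub_sq_pos (hk : 0 ≤ k) (ha0 : 0 ≤ a) (ha1 : a < 1) :
    0 < (1 + k) * (1 - a ^ 2) :=
  mul_pos (by linarith) (by nlinarith)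

theorem bohrRadius_lt_one (hk : 0 ≤ k) (hp : 0 < p) (ha0 : 0 ≤ a) (ha1 : a < 1) :
    bohrRadius k p a < 1 := by
  have h1 := one_sub_rpow_pos hp ha0 ha1
  have h2 := mul_one_sub_sq_pos hk ha0 ha1
  rw [bohrRadius, div_lt_one (by linarith)]
  linarith

theorem bohrRadius_pos (hk : 0 ≤ k) (hp : 0 < p) (ha0 : 0 ≤ a) (ha1 : a < 1) :
    0 < bohrRadius k p a := by
  have h1 := one_sub_rpow_pos hp ha0 ha1
  have h2 := mul_one_sub_sq_pos hk ha0 ha1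
  exact div_pos h1 (by linarith)

/-- Since p ≤ 2, a² ≤ a^p, so 1 - a^p ≤ 1 - a² ≤ (1+k)(1 - a²). -/
theorem bohrRadius_le_half (hk : 0 ≤ k) (hp : 0 < p) (hp2 : p ≤ 2) (ha0 : 0 ≤ a) (ha1 : a < 1) :
    bohrRadius k p a ≤ 1 / 2 := by
  have h1 := one_sub_rpow_pos hp ha0 ha1
  have h2 := mul_one_sub_sq_pos hk ha0 ha1
  have h3 : a ^ (2 : ℝ) ≤ a ^ p := Real.rpow_le_rpow_of_exponent_ge' ha0 ha1.le hp.le hp2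
  rw [Real.rpow_two] at h3
  rw [bohrRadius, div_le_div_iff₀ (by linarith) two_pos]
  have : 0 ≤ k * (1 - a ^ 2) := mul_nonneg hk (by nlinarith)
  linarith

theorem le_bohrRadius_iff (hk : 0 ≤ k) (hp : 0 < p) (ha0 : 0 ≤ a) (ha1 : a < 1) {r : ℝ}
    (hr1 : r < 1) :
    r ≤ bohrRadius k p a ↔ (1 + k) * ((1 - a ^ 2) * (r / (1 - r))) ≤ 1 - a ^ p := by
  have h1 := one_sub_rpow_pos hp ha0 ha1
  have h2 := mul_one_sub_sq_pos hk ha0 ha1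
  have h3 : 0 < 1 - r := by linarith
  rw [bohrRadius, le_div_iff₀ (by linarith), ← mul_assoc, ← mul_div_assoc, div_le_iff₀ h3]
  constructor <;> intro h <;> linarith

theorem bohrRadius_identity (hk : 0 ≤ k) (hp : 0 < p) (ha0 : 0 ≤ a) (ha1 : a < 1) :
    (1 + k) * ((1 - a ^ 2) * (bohrRadius k p a / (1 - bohrRadius k p a))) = 1 - a ^ p := by
  have h1 := one_sub_rpow_pos hp ha0 ha1
  have h2 := mul_one_sub_sq_pos hk ha0 ha1
  have h3 : bohrRadius k p a / (1 - bohrRadius k p a)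
      = (1 - a ^ p) / ((1 + k) * (1 - a ^ 2)) := by
    have h4 : 1 - a ^ p + (1 + k) * (1 - a ^ 2) ≠ 0 := by linarith
    have h5 : 1 - bohrRadius k p a
        = (1 + k) * (1 - a ^ 2) / (1 - a ^ p + (1 + k) * (1 - a ^ 2)) := by
      rw [bohrRadius, eq_div_iff h4, sub_mul, div_mul_cancel₀ _ h4]
      ring
    rw [h5, bohrRadius, div_div_div_cancel_right₀ h4]
  rw [h3, ← mul_assoc, mul_div_cancel₀ _ h2.ne']

end Radius

/-! ### The extremal disk automorphism -/

theorem taylorCoeff_const_succ (c : ℂ) (n : ℕ) : taylorCoeff (fun _ => c) (n + 1) = 0 := by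
  simp [taylorCoeff, iteratedDeriv_const]

theorem taylorCoeff_linear_one (α β : ℂ) : taylorCoeff (fun z => α + β * z) 1 = β := by
  have h := taylorCoeff_deriv (fun z => α + β * z) 0
  have e : deriv (fun z : ℂ => α + β * z) = fun _ => β := by
    funext z
    simp
  rw [e, taylorCoeff_zero] at h
  simpa using h.symm

theorem taylorCoeff_linear_add_two (α β : ℂ) (n : ℕ) :
    taylorCoeff (fun z => α + β * z) (n + 2) = 0 := by
  have h := taylorCoeff_deriv (fun z => α + β * z) (n + 1)
  have e : deriv (fun z : ℂ => α + β * z) = fun _ => β := by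
    funext z
    simp
  rw [e, taylorCoeff_const_succ] at h
  have hn : ((n + 1 : ℕ) : ℂ) + 1 ≠ 0 := by exact_mod_cast (n + 1).succ_ne_zero
  exact (mul_eq_zero.1 h.symm).resolve_left hn

/-- The disk automorphism exchanging `a` and `0`. -/
noncomputable def diskMoebius (a : ℝ) (z : ℂ) : ℂ := (a - z) / (1 - a * z)

section Moebius

variable {a : ℝ}

theorem one_sub_mul_ne_zero (ha0 : 0 ≤ a) (ha1 : a < 1) {z : ℂ} (hz : z ∈ ball (0 : ℂ) 1) :
    1 - (a : ℂ) * z ≠ 0 := by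
  intro h
  have h1 : ‖(a : ℂ) * z‖ = 1 := by rw [← sub_eq_zero.1 h, norm_one]
  rw [norm_mul, Complex.norm_real, Real.norm_of_nonneg ha0] at h1
  have hz' : ‖z‖ < 1 := by simpa using hz
  nlinarith [norm_nonneg z]

theorem differentiableOn_diskMoebius (ha0 : 0 ≤ a) (ha1 : a < 1) :
    DifferentiableOn ℂ (diskMoebius a) (ball 0 1) :=
  DifferentiableOn.div (by fun_prop) (by fun_prop) fun _ hz => one_sub_mul_ne_zero ha0 ha1 hz

theorem diskMoebius_zero (a : ℝ) : diskMoebius a 0 = a := by simp [diskMoebius]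

theorem norm_diskMoebius_le (ha0 : 0 ≤ a) (ha1 : a < 1) {z : ℂ} (hz : z ∈ ball (0 : ℂ) 1) :
    ‖diskMoebius a z‖ ≤ 1 := by
  rw [diskMoebius, norm_div]
  refine div_le_one_of_le₀ ?_ (norm_nonneg _)
  rw [← sq_le_sq₀ (norm_nonneg _) (norm_nonneg _), Complex.sq_norm, Complex.sq_norm,
    Complex.normSq_apply, Complex.normSq_apply]
  have hz' : ‖z‖ ^ 2 ≤ 1 := pow_le_one₀ (norm_nonneg _) (by simpa using (mem_ball.1 hz).le)
  rw [Complex.sq_norm, Complex.normSq_apply] at hz'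
  simp
  nlinarith [mul_nonneg (by nlinarith : 0 ≤ 1 - a ^ 2) (sub_nonneg.2 hz')]

theorem nonconst_diskMoebius (ha0 : 0 ≤ a) (ha1 : a < 1) : NonconstOnDisk (diskMoebius a) := by
  have hz : (1 / 2 : ℂ) ∈ ball (0 : ℂ) 1 := by simp; norm_num
  refine ⟨1 / 2, hz, fun h => ?_⟩
  rw [diskMoebius_zero, diskMoebius, div_eq_iff (one_sub_mul_ne_zero ha0 ha1 hz)] at h
  have h' : ((a ^ 2 : ℝ) : ℂ) = ((1 : ℝ) : ℂ) := by
    push_cast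
    linear_combination 2 * h
  have := Complex.ofReal_injective h'
  nlinarith

-- Comparing coefficients in (1 - az) · `diskMoebius a z` = a - z gives a first-order recursion of
-- ratio a.
open Finset in
theorem taylorCoeff_diskMoebius (ha0 : 0 ≤ a) (ha1 : a < 1) (n : ℕ) :
    taylorCoeff (diskMoebius a) (n + 1) = -((1 - a ^ 2) * a ^ n) := by
  have h0 : (0 : ℂ) ∈ ball (0 : ℂ) 1 := by simp
  have han := (differentiableOn_diskMoebius ha0 ha1).analyticOnNhd isOpen_ball 0 h0
  have hprod : ∀ m, taylorCoeff (fun z => (a : ℂ) + (-1) * z) (m + 1)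
      = taylorCoeff (diskMoebius a) (m + 1) - a * taylorCoeff (diskMoebius a) m := by
    intro m
    have e := taylorCoeff_mul han
      (by fun_prop : AnalyticAt ℂ (fun z : ℂ => 1 + (-(a : ℂ)) * z) 0) (m + 1)
    rw [sum_range_succ', sum_range_succ', sum_eq_zero
      fun j _ => by rw [taylorCoeff_linear_add_two, mul_zero]] at e
    rw [taylorCoeff_congr (v := fun z => diskMoebius a z * (1 + (-(a : ℂ)) * z)), e]
    · simp only [zero_add, taylorCoeff_linear_one]
      rw [taylorCoeff_zero (fun z : ℂ => 1 + (-(a : ℂ)) * z)]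
      simp
      ring
    · intro z hz
      have := one_sub_mul_ne_zero ha0 ha1 hz
      rw [diskMoebius, neg_mul (a : ℂ) z, ← sub_eq_add_neg, div_mul_cancel₀ _ this]
      ring
  induction n with
  | zero =>
    have h := hprod 0
    rw [zero_add, taylorCoeff_linear_one, taylorCoeff_zero, diskMoebius_zero] at h
    linear_combination -h
  | succ n ih =>
    have h := hprod (n + 1)
    rw [taylorCoeff_linear_add_two, ih] at h
    linear_combination -h

theorem norm_taylorCoeff_diskMoebius (ha0 : 0 ≤ a) (ha1 : a < 1) (n : ℕ) :
    ‖taylorCoeff (diskMoebius a) (n + 1)‖ = (1 - a ^ 2) * a ^ n := by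
  have : -((1 - (a : ℂ) ^ 2) * a ^ n) = ((-((1 - a ^ 2) * a ^ n) : ℝ) : ℂ) := by
    push_cast; rfl
  rw [taylorCoeff_diskMoebius ha0 ha1, this, Complex.norm_real, norm_neg, Real.norm_of_nonneg]
  exact mul_nonneg (by nlinarith) (pow_nonneg ha0 n)

theorem majorant_diskMoebius (ha0 : 0 ≤ a) (ha1 : a < 1) {r : ℝ} (hr0 : 0 ≤ r) (hr1 : r < 1) :
    majorant (diskMoebius a) r = (1 - a ^ 2) * r / (1 - a * r) := by
  have hlt : a * r < 1 := by nlinarith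
  have h := (hasSum_geometric_of_lt_one (mul_nonneg ha0 hr0) hlt).mul_left ((1 - a ^ 2) * r)
  rw [majorant, div_eq_mul_inv, ← h.tsum_eq]
  refine tsum_congr fun n => ?_
  rw [norm_taylorCoeff_diskMoebius ha0 ha1]
  ring

theorem normSqR_diskMoebius (ha0 : 0 ≤ a) (ha1 : a < 1) {r : ℝ} (hr0 : 0 ≤ r) (hr1 : r < 1) :
    normSqR (diskMoebius a) r = ((1 - a ^ 2) * r) ^ 2 / (1 - (a * r) ^ 2) := by
  have hlt : a * r < 1 := by nlinarith
  have h := (hasSum_geometric_of_lt_one (sq_nonneg (a * r))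
    (pow_lt_one₀ (mul_nonneg ha0 hr0) hlt two_ne_zero)).mul_left (((1 - a ^ 2) * r) ^ 2)
  rw [normSqR, div_eq_mul_inv, ← h.tsum_eq]
  refine tsum_congr fun n => ?_
  rw [norm_taylorCoeff_diskMoebius ha0 ha1]
  ring

/-- As g = k (h - h(0)) and c(k) k² = k, a factor 1 + k comes out. The geometric series leave A
r/(1-ar) · (1 + (1-a) r/(1-r)), and the last factor is (1-ar)/(1-r). -/
theorem bohrE_diskMoebius {k : ℝ} (hk : 0 ≤ k) (ha0 : 0 ≤ a) (ha1 : a < 1) {r : ℝ}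
    (hr0 : 0 ≤ r) (hr1 : r < 1) :
    bohrE k (diskMoebius a) (fun z => k * (diskMoebius a z - a)) r
      = (1 + k) * ((1 - a ^ 2) * (r / (1 - r))) := by
  have hg : ∀ n, ‖taylorCoeff (fun z => (k : ℂ) * (diskMoebius a z - a)) (n + 1)‖
      = k * ‖taylorCoeff (diskMoebius a) (n + 1)‖ := by
    intro n
    rw [← taylorCoeff_sub_const (diskMoebius a) a, taylorCoeff, iteratedDeriv_const_mul_field,
      mul_div_assoc, norm_mul, Complex.norm_real, Real.norm_of_nonneg hk, taylorCoeff]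
  have hM : majorant (fun z => (k : ℂ) * (diskMoebius a z - a)) r
      = k * majorant (diskMoebius a) r := by
    simp only [majorant, hg, mul_assoc, tsum_mul_left]
  have hN : normSqR (fun z => (k : ℂ) * (diskMoebius a z - a)) r
      = k ^ 2 * normSqR (diskMoebius a) r := by
    simp only [normSqR, hg, mul_pow, mul_assoc, tsum_mul_left]
  have hn : ‖diskMoebius a 0‖ = a := by
    rw [diskMoebius_zero, Complex.norm_real, Real.norm_of_nonneg ha0]
  rw [bohrE, hM, hN, normSqR_sub_const, hn, ← mul_assoc (cCoeff k), cCoeff_mul_sq,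
    majorant_diskMoebius ha0 ha1 hr0 hr1, normSqR_diskMoebius ha0 ha1 hr0 hr1]
  have h1 : 1 - r ≠ 0 := by linarith
  have hlt : a * r < 1 := by nlinarith
  have h2 : 1 - a * r ≠ 0 := by linarith
  have h3 : 1 + a * r ≠ 0 := by nlinarith [mul_nonneg ha0 hr0]
  have h4 : 1 + a ≠ 0 := by linarith
  have h5 : 1 - (a * r) ^ 2 = (1 - a * r) * (1 + a * r) := by ring
  rw [h5]
  field_simp
  ring

theorem isInHk_diskMoebius {k : ℝ} (hk : 0 ≤ k) (ha0 : 0 ≤ a) (ha1 : a < 1) :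
    IsInHk k (fun z => diskMoebius a z + (starRingEnd ℂ) (k * (diskMoebius a z - a)))
      (diskMoebius a) (fun z => k * (diskMoebius a z - a)) where
  analytic_h := differentiableOn_diskMoebius ha0 ha1
  analytic_g := ((differentiableOn_diskMoebius ha0 ha1).sub_const _).const_mul _
  g_zero := by rw [diskMoebius_zero, sub_self, mul_zero]
  decomp _ _ := rfl
  norm_h_le _ hz := norm_diskMoebius_le ha0 ha1 hz
  norm_deriv_le z _ := by
    rw [deriv_const_mul_field, deriv_sub_const, norm_mul, Complex.norm_real,
      Real.norm_of_nonneg hk]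

end Moebius

/-! ### Conclusion -/

theorem rpow_add_bohrE_le_one {k p : ℝ} (hk : 0 ≤ k) (hp0 : 0 < p) (hp2 : p ≤ 2)
    {f h g : ℂ → ℂ} (hf : IsInHk k f h g) (hn : NonconstOnDisk h) {r : ℝ} (hr0 : 0 ≤ r)
    (hr : r ≤ bohrRadius k p ‖h 0‖) : ‖h 0‖ ^ p + bohrE k h g r ≤ 1 := by
  have ha0 := norm_nonneg (h 0)
  have ha1 := norm_zero_lt_one hf.analytic_h hf.norm_h_le hn
  have hr' := hr.trans (bohrRadius_le_half hk hp0 hp2 ha0 ha1)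
  have h1 := bohrE_le hk hf hr0 hr'
  have h2 := (le_bohrRadius_iff hk hp0 ha0 ha1 (by linarith)).1 hr
  linarith

end BohrHarmonic

open BohrHarmonic in
theorem corollary5 (k p : ℝ) (hk0 : 0 ≤ k) (hk1 : k ≤ 1) (hp0 : 0 < p) (hp2 : p ≤ 2) :
    -- the inequality under the condition on the coefficients
    (∀ f h g : ℂ → ℂ, IsInHk k f h g → NonconstOnDisk h →
      ∀ q : ℕ, analyticOrderAt (fun z => h z - h 0) 0 = (q : ℕ∞) →
      (0 < k → ‖taylorCoeff g q‖ ≤ 1 / (2 * k * ‖taylorCoeff h q‖)) →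
      ∀ r : ℝ, 0 ≤ r → r ≤ bohrRadius k p ‖h 0‖ →
        ‖h 0‖ ^ p + bohrE k h g r ≤ 1) ∧
    -- the inequality without it
    (∀ f h g : ℂ → ℂ, IsInHk k f h g → NonconstOnDisk h → FreeRange k p ‖h 0‖ →
      ∀ r : ℝ, 0 ≤ r → r ≤ bohrRadius k p ‖h 0‖ →
        ‖h 0‖ ^ p + bohrE k h g r ≤ 1) ∧
    -- sharpness
    (∀ a : ℝ, 0 ≤ a → a < 1 → FreeRange k p a →
      ∃ f h g : ℂ → ℂ, IsInHk k f h g ∧ NonconstOnDisk h ∧ ‖h 0‖ = a ∧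
        a ^ p + bohrE k h g (bohrRadius k p a) = 1 ∧
        ∀ r : ℝ, bohrRadius k p a < r → r < 1 → 1 < a ^ p + bohrE k h g r) := by
  refine ⟨fun f h g hf hn _ _ _ r hr0 hr => rpow_add_bohrE_le_one hk0 hp0 hp2 hf hn hr0 hr,
    fun f h g hf hn _ r hr0 hr => rpow_add_bohrE_le_one hk0 hp0 hp2 hf hn hr0 hr,
    fun a ha0 ha1 _ => ?_⟩
  have hR0 := bohrRadius_pos hk0 hp0 ha0 ha1
  refine ⟨_, diskMoebius a, _, isInHk_diskMoebius hk0 ha0 ha1, nonconst_diskMoebius ha0 ha1,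
    ?_, ?_, fun r hr hr1 => ?_⟩
  · rw [diskMoebius_zero, Complex.norm_real, Real.norm_of_nonneg ha0]
  · rw [bohrE_diskMoebius hk0 ha0 ha1 hR0.le (bohrRadius_lt_one hk0 hp0 ha0 ha1),
      bohrRadius_identity hk0 hp0 ha0 ha1]
    ring
  · rw [bohrE_diskMoebius hk0 ha0 ha1 (hR0.le.trans hr.le) hr1]
    have := mt (le_bohrRadius_iff hk0 hp0 ha0 ha1 hr1).2 (not_le.2 hr)
    linarith
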